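/- **Conventions.** Points $t$ with prescribed argument lie on the universal covering of $\mathbb C\setminus\{0\}$, and powers of $t$ are taken there. $D_r=\{|z|<r\}$; $S_d(\alpha)$ is the open sector in direction $d$ with opening $\alpha$, $S_d(\alpha,r)$ its part with $|t|<r$; $\mathcal L_d$ is the ray in direction $d$. $\mathcal O^k(U)$ denotes the functions holomorphic on $U$ that satisfy $|f(s)|\le C_1e^{C_2|s|^k}$ on every closed subsector contained in $U$. A formal series $\hat f=\sum f_nt^n$ is 1-summable in direction $d$ if $g(s)=\sum f_n\frac{n!}{(2n)!}s^n$ converges near $0$ and continues to a function in $\mathcal O^1(D_\varrho\cup S_d(\epsilon))$ for some $\epsilon,\varrho>0$; its 1-sum is $f^d(t)=t^{-1/2}\int_{e^{id}\mathbb R_+}g(s)\,C_2\big((s/t)^{1/2}\big)\,ds^{1/2}$ with the Ecalle kernel $C_2(\tau)=\sum_n\frac{(-\tau)^n}{n!\,\Gamma(1-\frac{n+1}2)}$. $\mathcal L_d$ is a Stokes line if $\hat f$ is 1-summable in all directions but finitely many modulo $2\pi$, and $d$ is one of the exceptions. A hyperfunction $[g]_d$ is the class of $g\in\mathcal O^2\big(D_\varrho\cup(S_\theta(\alpha)\setminus\mathcal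 L_d)\big)$ modulo $\mathcal O^2\big(D_\varrho\cup S_\theta(\alpha)\big)$; it acts on functions $\psi$ by $[g]_d[\psi]=\int_\gamma g\psi\,ds$, where $\gamma$ comes in from infinity along $\mathcal L_{d^-}$ to $0$ and goes out along $\mathcal L_{d^+}$, with $d^-<d<d^+$ in the sector and $g$ a defining function for which the integrals converge. On a ray through $c$, $\delta^{(m)}(s-c)$ is the class of $\frac{d^m}{ds^m}\frac{-1}{2\pi i(s-c)}$. **Theorem.** Let $z_0\ne0$, let $\theta$ be a value of $\arg z_0$, and let $\delta=2\theta$ (a direction, not to be confused with the Dirac function). Let $\varphi$ be a (single-valued) holomorphic function on $\mathbb C\setminus\{z_0\}$ with $$\varphi(z)=\sum_{n\ge1}\frac{a_n}{(z-z_0)^n}+\phi(z),\qquad \limsup_{n\to\infty}|a_n|^{1/n}<1,\qquad \phi\in\mathcal O^2(\mathbb C),$$ where the expansion is required for $|z-z_0|\ge1$. Let $\hat u(t,z)=\sum_n u_n(z)t^n$, with $u_n$ holomorphic on $D_R$, $R>0$, be the formal solution of $\partial_tu=\partial_z^2u$, $u(0,z)=\varphi(z)$. For $|z|<|z_0|$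 let $\theta_z$ be the value of $\arg(z_0-z)$ that is continuous in $z$ and equal to $\theta$ at $z=0$. 1. If some $a_n\neq0$ ($n\ge1$), then for every $z$ with $|z|<\min(R,|z_0|)$ the line $\mathcal L_{2\theta_z}$ is a Stokes line of $\hat u(\cdot,z)$; for $z=0$ this is $\mathcal L_\delta$. 2. Let $0<\alpha<\pi$ and $0<\varrho<|z_0|$. For all $z$ in a sufficiently small disc around $0$ the point $z_0-z$ lies in $S_\theta(\alpha)$, and the hyperfunction $F_z(s)=[\varphi(s+z)+\varphi(z-s)]_{\theta_z}$ satisfies $$F_z(s)=[\varphi(s+z)]_{\theta_z}=\Big[\sum_{n\ge1}\frac{a_n}{(z+s-z_0)^n}\Big]_{\theta_z}=-2\pi i\sum_{n\ge1}\frac{a_n(-1)^{n-1}}{(n-1)!}\,\delta^{(n-1)}(z+s-z_0).$$ The last series converges locally uniformly on the level of the standard defining functions, and also as analytic functionals: for every $\psi$ holomorphic and exponentially decreasing of order 2 (on closed subsectors) on $D_\varrho\cup S_\theta(\alpha)$ one has $\delta^{(m)}(z+s-z_0)[\psi]=(-1)^m\psi^{(m)}(z_0-z)$, and the values of the terms at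 $\psi$ sum to $F_z[\psi]$. 3. For every $\varepsilon\in(0,\pi)$ there is $\eta>0$ such that for all $0<\alpha\le\varepsilon/2$, $0<\varrho<|z_0|$, $\delta^+\in(\delta,\delta+\eta)$ and $\delta^-\in(\delta-\eta,\delta)$ there is $r>0$ such that for all $z\in D_r$: $z_0-z\in S_\theta(\alpha)$, the series $\hat u(\cdot,z)$ is 1-summable in the directions $\delta^\pm$, and for all $t\in S_\delta(\pi-\varepsilon,r)$ the integrals defining the 1-sums $u^{\delta^\pm}(t,z)$ converge absolutely and $$u^{\delta^+}(t,z)-u^{\delta^-}(t,z)=F_z(s)\Big[\tfrac1{\sqrt{4\pi t}}e^{-s^2/4t}\Big]=-i\sqrt{\frac{\pi}{t}}\sum_{n=1}^\infty\frac{a_n}{(n-1)!}\,\frac{d^{n-1}}{ds^{n-1}}e^{-s^2/4t}\Big|_{s=z_0-z},$$ where the last series converges. -/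

import Mathlib

open Filter Topology MeasureTheory Set

noncomputable section

/-! ### Sectors and exponential growth -/

/-- The complex number `r e^{i x}`. The pair `(r, x)` with `0 < r` is a point of the universal
covering of `ℂ ∖ {0}`, and `polar r x` is its projection. -/
def polar (r x : ℝ) : ℂ := (r : ℂ) * Complex.exp (Complex.I * (x : ℂ))

/-- The unbounded sector in direction `d` with opening `α`. -/
def sector (d α : ℝ) : Set ℂ :=
  {s | ∃ r x : ℝ, 0 < r ∧ d - α / 2 < x ∧ x < d + α / 2 ∧ s = polar r x}

/-- The open half-line from `0` in direction `d`. -/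
def ray (d : ℝ) : Set ℂ := {s | ∃ r : ℝ, 0 < r ∧ s = polar r d}

/-- A sector together with the disc of radius `ρ`. -/
def hatSector (d α ρ : ℝ) : Set ℂ := Metric.ball 0 ρ ∪ sector d α

/-- The disc of radius `ρ` together with the sector in direction `θ` with opening `α`, slit along
the half-line in direction `d`. -/
def slitSector (θ α ρ d : ℝ) : Set ℂ := Metric.ball 0 ρ ∪ (sector θ α \ ray d)

/-- The closed infinite sector of directions `β₁ ≤ x ≤ β₂` (without its vertex) lies in `U`. -/
def ClosedSubsector (U : Set ℂ) (β₁ β₂ : ℝ) : Prop :=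
  ∀ r x : ℝ, 0 < r → β₁ ≤ x → x ≤ β₂ → polar r x ∈ U

/-- Holomorphic on `U` and of exponential growth of order at most `k` there: on every closed
subsector contained in `U` there is a bound `C₁ exp (C₂ |s| ^ k)`. For `U = ℂ` this is a global
bound, because `ℂ ∖ {0}` is itself such a subsector. -/
def ExpGrowth (k : ℝ) (U : Set ℂ) (f : ℂ → ℂ) : Prop :=
  DifferentiableOn ℂ f U ∧
    ∀ β₁ β₂ : ℝ, ClosedSubsector U β₁ β₂ →
      ∃ C₁ C₂ : ℝ, 0 < C₁ ∧ 0 < C₂ ∧ ∀ r x : ℝ, 0 < r → β₁ ≤ x → x ≤ β₂ →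
        ‖f (polar r x)‖ ≤ C₁ * Real.exp (C₂ * r ^ k)

/-- Holomorphic on `U` and exponentially decreasing of order `k`: on every closed subsector
contained in `U` there is a bound `C₁ exp (-C₂ |s| ^ k)` with `C₂ > 0`. -/
def ExpDecay (k : ℝ) (U : Set ℂ) (f : ℂ → ℂ) : Prop :=
  DifferentiableOn ℂ f U ∧
    ∀ β₁ β₂ : ℝ, ClosedSubsector U β₁ β₂ →
      ∃ C₁ C₂ : ℝ, 0 < C₁ ∧ 0 < C₂ ∧ ∀ r x : ℝ, 0 < r → β₁ ≤ x → x ≤ β₂ →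
        ‖f (polar r x)‖ ≤ C₁ * Real.exp (-(C₂ * r ^ k))

/-! ### Summability -/

/-- The Ecalle kernel `C_α(τ) = ∑ (-τ)^n / (n! Γ(1 - (n+1)/α))`. At the poles of `Γ` Mathlib has
`Γ = 0` and `x / 0 = 0`, which agrees with the usual reading `1 / Γ = 0`. -/
def ecalleKernel (α : ℝ) (τ : ℂ) : ℂ :=
  ∑' n : ℕ, (-τ) ^ n / ((n.factorial : ℂ) * (Real.Gamma (1 - ((n : ℝ) + 1) / α) : ℂ))

/-- Integrand of the acceleration operator in direction `d` at the point `(r, ψ)` (that is,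
`t = r e^{iψ}`) of the universal covering, with `s = x e^{id}` parametrized by `x > 0`:
`g(s) C_{k₁/k₂}((s/t)^{k₂}) d(s^{k₂})/dx`, all powers being taken on the universal covering. -/
def accelIntegrand (k₁ k₂ d : ℝ) (g : ℂ → ℂ) (r ψ x : ℝ) : ℂ :=
  g (polar x d) * ecalleKernel (k₁ / k₂) (polar ((x / r) ^ k₂) (k₂ * (d - ψ))) *
    ((k₂ : ℂ) * polar (x ^ (k₂ - 1)) (k₂ * d))

/-- The acceleration operator `t^{-k₂} ∫ g(s) C_{k₁/k₂}((s/t)^{k₂}) d(s^{k₂})` in direction `d`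
with indices `k₁ > k₂`, at `t = r e^{iψ}` on the universal covering. -/
def acceleration (k₁ k₂ d : ℝ) (g : ℂ → ℂ) (r ψ : ℝ) : ℂ :=
  (polar (r ^ k₂) (k₂ * ψ))⁻¹ * ∫ x in Ioi (0 : ℝ), accelIntegrand k₁ k₂ d g r ψ x

/-- The formal deceleration operator with indices `k₁` and `k₂`. -/
def formalDeceleration (k₁ k₂ : ℝ) (f : PowerSeries ℂ) : PowerSeries ℂ :=
  PowerSeries.mk fun n => PowerSeries.coeff n f *
    ((Real.Gamma (1 + (n : ℝ) / k₁) / Real.Gamma (1 + (n : ℝ) / k₂) : ℝ) : ℂ)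

/-- The decelerated series of `f` converges near `0` and its sum `g` continues to a function of
exponential growth of order at most `k` in some sector in direction `d` together with a disc. -/
def IsContinuedDeceleration (k d : ℝ) (f : PowerSeries ℂ) (g : ℂ → ℂ) : Prop :=
  ∃ ε ρ : ℝ, 0 < ε ∧ 0 < ρ ∧ ExpGrowth k (hatSector d ε ρ) g ∧
    ∀ s ∈ Metric.ball (0 : ℂ) ρ,
      HasSum (fun n : ℕ => PowerSeries.coeff n (formalDeceleration 1 (k / (k + 1)) f) * s ^ n) (g s)

/-- `f` is `k`-summable in the direction `d`. -/
def KSummable (k d : ℝ) (f : PowerSeries ℂ) : Prop :=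
  ∃ g : ℂ → ℂ, IsContinuedDeceleration k d f g

open Classical in
/-- The continued decelerated series; on the sector and disc in question it is unique. -/
def continuedDeceleration (k d : ℝ) (f : PowerSeries ℂ) : ℂ → ℂ :=
  if h : KSummable k d f then h.choose else 0

/-- The integral that defines the `k`-sum of `f` in direction `d` at `(r, ψ)` converges. -/
def KSumConverges (k d : ℝ) (f : PowerSeries ℂ) (r ψ : ℝ) : Prop :=
  IntegrableOn (accelIntegrand 1 (k / (k + 1)) d (continuedDeceleration k d f) r ψ) (Ioi 0)

/-- The `k`-sum of `f` in the direction `d` at the point `(r, ψ)` of the universal covering. -/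
def kSum (k d : ℝ) (f : PowerSeries ℂ) (r ψ : ℝ) : ℂ :=
  acceleration 1 (k / (k + 1)) d (continuedDeceleration k d f) r ψ

/-- `f` is `k`-summable in all but finitely many directions modulo `2π`, and `d` is one of the
exceptional (singular) directions. -/
def IsStokesLine (k d : ℝ) (f : PowerSeries ℂ) : Prop :=
  {β : Real.Angle | ∃ x : ℝ, (x : Real.Angle) = β ∧ ¬ KSummable k x f}.Finite ∧ ¬ KSummable k d f

/-! ### Laplace type hyperfunctions -/

/-- The space of functions holomorphic of exponential growth of order at most `k` on `U`. -/
def expGrowthSpace (k : ℝ) (U : Set ℂ) : Submodule ℂ (ℂ → ℂ) where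
  carrier := {f | ExpGrowth k U f}
  zero_mem' := ⟨differentiableOn_const 0, fun _ _ _ =>
    ⟨1, 1, one_pos, one_pos, fun r x _ _ _ => by simp; positivity⟩⟩
  add_mem' := by
    rintro f g ⟨hf, hf'⟩ ⟨hg, hg'⟩
    refine ⟨hf.add hg, fun β₁ β₂ h => ?_⟩
    obtain ⟨A, B, hA, hB, hAB⟩ := hf' β₁ β₂ h
    obtain ⟨A', B', hA', hB', hAB'⟩ := hg' β₁ β₂ h
    refine ⟨A + A', B + B', by positivity, by positivity, fun r x hr h1 h2 => ?_⟩
    have hk : 0 ≤ r ^ k := Real.rpow_nonneg hr.le k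
    have e1 : Real.exp (B * r ^ k) ≤ Real.exp ((B + B') * r ^ k) := by
      apply Real.exp_le_exp.2; nlinarith
    have e2 : Real.exp (B' * r ^ k) ≤ Real.exp ((B + B') * r ^ k) := by
      apply Real.exp_le_exp.2; nlinarith
    calc ‖(f + g) (polar r x)‖ ≤ ‖f (polar r x)‖ + ‖g (polar r x)‖ := norm_add_le _ _
      _ ≤ A * Real.exp (B * r ^ k) + A' * Real.exp (B' * r ^ k) :=
        add_le_add (hAB r x hr h1 h2) (hAB' r x hr h1 h2)
      _ ≤ A * Real.exp ((B + B') * r ^ k) + A' * Real.exp ((B + B') * r ^ k) := by gcongr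
      _ = _ := by ring
  smul_mem' := by
    rintro c f ⟨hf, hf'⟩
    refine ⟨hf.const_smul c, fun β₁ β₂ h => ?_⟩
    obtain ⟨A, B, hA, hB, hAB⟩ := hf' β₁ β₂ h
    refine ⟨(‖c‖ + 1) * A, B, by positivity, hB, fun r x hr h1 h2 => ?_⟩
    have := hAB r x hr h1 h2
    calc ‖(c • f) (polar r x)‖ = ‖c‖ * ‖f (polar r x)‖ := by simp
      _ ≤ (‖c‖ + 1) * (A * Real.exp (B * r ^ k)) := by gcongr; linarith
      _ = _ := by ring

/-- Inside the functions on the slit domain, those that extend across the slit (on the slit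
domain they agree with a function of the same growth on the unslit domain). -/
def extendable (k θ α ρ d : ℝ) : Submodule ℂ (expGrowthSpace k (slitSector θ α ρ d)) where
  carrier := {g | ∃ h ∈ expGrowthSpace k (hatSector θ α ρ), EqOn g.1 h (slitSector θ α ρ d)}
  zero_mem' := ⟨0, Submodule.zero_mem _, fun _ _ => rfl⟩
  add_mem' := by
    rintro f g ⟨h, hh, e⟩ ⟨h', hh', e'⟩
    exact ⟨h + h', Submodule.add_mem _ hh hh', fun s hs => congrArg₂ (· + ·) (e hs) (e' hs)⟩
  smul_mem' := by
    rintro c f ⟨h, hh, e⟩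
    exact ⟨c • h, Submodule.smul_mem _ c hh, fun s hs => congrArg (c • ·) (e hs)⟩

/-- Laplace type hyperfunctions of exponential growth of order `k`, supported by the half-line in
direction `d` inside the sector in direction `θ` with opening `α` (and the disc of radius `ρ`):
functions on the slit domain modulo functions on the unslit domain. -/
abbrev LaplaceHyperfunction (k θ α ρ d : ℝ) : Type :=
  ↥(expGrowthSpace k (slitSector θ α ρ d)) ⧸ extendable k θ α ρ d

/-- `g` is a defining function of the hyperfunction `G`, i.e. `G = [g]_d`. -/
def IsDefiningFunction {k θ α ρ d : ℝ} (G : LaplaceHyperfunction k θ α ρ d) (g : ℂ → ℂ) : Prop :=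
  ∃ h : g ∈ expGrowthSpace k (slitSector θ α ρ d),
    (Submodule.Quotient.mk ⟨g, h⟩ : LaplaceHyperfunction k θ α ρ d) = G

/-- The integral of `f` along the half-line from `0` to infinity in direction `x`. -/
def rayIntegral (f : ℂ → ℂ) (x : ℝ) : ℂ :=
  ∫ r in Ioi (0 : ℝ), f (polar r x) * Complex.exp (Complex.I * (x : ℂ))

/-- The value `G[ψ]` of the hyperfunction `G`, as an analytic functional, is `v`: for a defining
function `g` of `G` the integral of `g ψ` along the path that comes in from infinity in direction
`dm` and goes out to infinity in direction `dp` converges and equals `v`, for all directions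
`dm < d < dp` in the sector. -/
def HasPairing {k θ α ρ d : ℝ} (G : LaplaceHyperfunction k θ α ρ d) (ψ : ℂ → ℂ) (v : ℂ) : Prop :=
  ∃ g : ℂ → ℂ, IsDefiningFunction G g ∧
    ∀ dm dp : ℝ, θ - α / 2 < dm → dm < d → d < dp → dp < θ + α / 2 →
      IntegrableOn (fun r : ℝ => g (polar r dm) * ψ (polar r dm)) (Ioi 0) ∧
      IntegrableOn (fun r : ℝ => g (polar r dp) * ψ (polar r dp)) (Ioi 0) ∧
      rayIntegral (fun s => g s * ψ s) dp - rayIntegral (fun s => g s * ψ s) dm = v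

/-- The standard defining function of the `m`-th derivative of the Dirac function at `c`: the
`m`-th derivative of `-1 / (2πi (s - c))`. -/
def diracFunction (m : ℕ) (c : ℂ) : ℂ → ℂ :=
  iteratedDeriv m fun s : ℂ => -1 / (2 * (Real.pi : ℂ) * Complex.I * (s - c))

/-! ### The heat equation -/

/-- `∑ u n z * t ^ n` is the formal power series solution, with coefficients holomorphic on the
disc of radius `R`, of `∂ₜ u = ∂_z² u`, `u(0, z) = φ z`. -/
def IsFormalHeatSolution (φ : ℂ → ℂ) (R : ℝ) (u : ℕ → ℂ → ℂ) : Prop :=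
  (∀ n : ℕ, DifferentiableOn ℂ (u n) (Metric.ball 0 R)) ∧
  (∀ z ∈ Metric.ball (0 : ℂ) R, u 0 z = φ z) ∧
  ∀ n : ℕ, ∀ z ∈ Metric.ball (0 : ℂ) R, ((n : ℂ) + 1) * u (n + 1) z = iteratedDeriv 2 (u n) z

/-- The formal power series in `t` obtained by fixing `z`. -/
def seriesAt (u : ℕ → ℂ → ℂ) (z : ℂ) : PowerSeries ℂ := PowerSeries.mk fun n => u n z

/-- The function `s ↦ exp (-s² / (4t)) / √(4πt)` for `t = r e^{iψ}` on the universal covering,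
where `√t = √r e^{iψ/2}`. -/
def heatKernel (r ψ : ℝ) (s : ℂ) : ℂ :=
  1 / ((Real.sqrt (4 * Real.pi) : ℂ) * polar (Real.sqrt r) (ψ / 2)) *
    Complex.exp (-s ^ 2 / (4 * polar r ψ))

/-- The argument of `z₀ - z` continued from the value `θ` at `z = 0` (for `|z| < |z₀|`). -/
def argAt (z₀ : ℂ) (θ : ℝ) (z : ℂ) : ℝ := θ + Complex.arg ((z₀ - z) / z₀)

end

/-! The deceleration of order `1` turns the formal heat series `∑ f⁽²ⁿ⁾(0) tⁿ / n!` of an initial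
value `f` into the series of the even part of `f`, read as a function of `s = w ^ 2`. It therefore
continues to every sector in which `f` has no singularity, and at `p ^ 2`, where `p` is the
singularity of `f`, it cannot be continued, since a nonzero principal part at `p` would then be
holomorphic everywhere and vanish at infinity.

The substitution `s = w ^ 2` also turns the `1`-sum in direction `d` into the integral of
`f w + f (-w)` against the heat kernel along the half-line of direction `d / 2`. Between two
directions on either side of `p ^ 2`, everything except the principal part of `f` at `p` can be
rotated from one half-line to the other, so the jump of the sum is the pairing of the heat kernel
with the hyperfunction of the principal part. Each term of the latter is evaluated by Cauchy's
formula in the sector; the pole of order `n + 1` is reduced to the simple pole by subtracting from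
the test function its value at `p`. -/

noncomputable section

/-! ### Polar coordinates -/

lemma norm_polar {r : ℝ} (hr : 0 ≤ r) (x : ℝ) : ‖polar r x‖ = r := by
  rw [polar, norm_mul, mul_comm Complex.I, Complex.norm_exp_ofReal_mul_I, mul_one,
    Complex.norm_real, Real.norm_of_nonneg hr]

lemma polar_zero (x : ℝ) : polar 0 x = 0 := by simp [polar]

lemma polar_ne_zero {r : ℝ} (hr : 0 < r) (x : ℝ) : polar r x ≠ 0 := by
  rw [← norm_pos_iff, norm_polar hr.le]; exact hr

lemma polar_mul (r s x y : ℝ) : polar r x * polar s y = polar (r * s) (x + y) := by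
  simp only [polar, Complex.ofReal_mul, Complex.ofReal_add, mul_add, Complex.exp_add]; ring

lemma polar_sq (r x : ℝ) : polar r x ^ 2 = polar (r ^ 2) (2 * x) := by
  rw [sq, polar_mul, ← sq, two_mul]

lemma polar_add_pi (r x : ℝ) : polar r (x + Real.pi) = -polar r x := by
  simp only [polar, Complex.ofReal_add, mul_add, Complex.exp_add, mul_comm Complex.I (Real.pi : ℂ),
    Complex.exp_pi_mul_I]
  ring

lemma polar_eq_exp {r : ℝ} (hr : 0 < r) (x : ℝ) :
    polar r x = Complex.exp ((Real.log r : ℝ) + (x : ℂ) * Complex.I) := by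
  rw [polar, Complex.exp_add, ← Complex.ofReal_exp, Real.exp_log hr, mul_comm Complex.I]

lemma exp_eq_polar (w : ℂ) : Complex.exp w = polar (Real.exp w.re) w.im := by
  conv_lhs => rw [← Complex.re_add_im w, Complex.exp_add]
  rw [polar, Complex.ofReal_exp, mul_comm Complex.I]

lemma polar_re (r x : ℝ) : (polar r x).re = r * Real.cos x := by
  rw [polar, mul_comm Complex.I, Complex.re_ofReal_mul, Complex.exp_ofReal_mul_I_re]

lemma polar_im (r x : ℝ) : (polar r x).im = r * Real.sin x := by
  rw [polar, mul_comm Complex.I, Complex.im_ofReal_mul, Complex.exp_ofReal_mul_I_im]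

@[fun_prop]
lemma continuous_polar : Continuous fun q : ℝ × ℝ => polar q.1 q.2 := by
  unfold polar; fun_prop

lemma continuous_polar_left (x : ℝ) : Continuous fun r : ℝ => polar r x := by
  unfold polar; fun_prop

lemma hasDerivAt_polar (r x : ℝ) :
    HasDerivAt (fun r : ℝ => polar r x) (Complex.exp (Complex.I * x)) r := by
  simpa [polar] using
    (Complex.ofRealCLM.hasDerivAt (x := r)).mul_const (Complex.exp (Complex.I * x))

lemma coe_arg_polar {r : ℝ} (hr : 0 < r) (x : ℝ) :
    (Complex.arg (polar r x) : Real.Angle) = x := by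
  have h := Complex.arg_mul_cos_add_sin_mul_I_coe_angle hr (x : Real.Angle)
  rwa [Real.Angle.cos_coe, Real.Angle.sin_coe, Complex.ofReal_cos, Complex.ofReal_sin,
    ← Complex.exp_mul_I, mul_comm (x : ℂ)] at h

lemma polar_eq_polar_iff {r s x y : ℝ} (hr : 0 < r) (hs : 0 < s) :
    polar r x = polar s y ↔ r = s ∧ (x : Real.Angle) = y := by
  constructor
  · intro h
    refine ⟨by simpa only [norm_polar hr.le, norm_polar hs.le] using congrArg norm h, ?_⟩
    rw [← coe_arg_polar hr, h, coe_arg_polar hs]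
  · rintro ⟨rfl, h⟩
    apply Complex.ext
    · rw [polar_re, polar_re, ← Real.Angle.cos_coe, h, Real.Angle.cos_coe]
    · rw [polar_im, polar_im, ← Real.Angle.sin_coe, h, Real.Angle.sin_coe]

lemma polar_norm_arg (z : ℂ) : polar ‖z‖ (Complex.arg z) = z := by
  rw [polar, mul_comm Complex.I, Complex.norm_mul_exp_arg_mul_I]

lemma eq_of_angle_coe_eq {x y : ℝ} (h : (x : Real.Angle) = y) (hxy : |x - y| < 2 * Real.pi) :
    x = y := by
  obtain ⟨h₁, h₂⟩ := abs_lt.1 hxy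
  have : Fact (0 < 2 * Real.pi) := ⟨Real.two_pi_pos⟩
  refine (AddCircle.coe_eq_coe_iff_of_mem_Ico (a := min x y) ?_ ?_).1 h
  · exact ⟨min_le_left x y, by rcases min_cases x y with h | h <;> linarith [Real.pi_pos]⟩
  · exact ⟨min_le_right x y, by rcases min_cases x y with h | h <;> linarith [Real.pi_pos]⟩

lemma polar_ne_polar {r s x y : ℝ} (hr : 0 < r) (hs : 0 < s) (hne : x ≠ y)
    (hxy : |x - y| < 2 * Real.pi) : polar r x ≠ polar s y := fun h =>
  hne (eq_of_angle_coe_eq ((polar_eq_polar_iff hr hs).1 h).2 hxy)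

/-! ### Sectors -/

lemma isOpen_sector (d α : ℝ) : IsOpen (sector d α) := by
  have : sector d α = Complex.exp '' (Complex.im ⁻¹' Ioo (d - α / 2) (d + α / 2)) := by
    ext s
    constructor
    · rintro ⟨r, x, hr, h1, h2, rfl⟩
      exact ⟨(Real.log r : ℝ) + (x : ℂ) * Complex.I, by simp [h1, h2], (polar_eq_exp hr x).symm⟩
    · rintro ⟨w, ⟨h1, h2⟩, rfl⟩
      exact ⟨Real.exp w.re, w.im, Real.exp_pos _, h1, h2, exp_eq_polar w⟩
  rw [this]
  exact Complex.isOpenMap_exp _ (isOpen_Ioo.preimage Complex.continuous_im)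

lemma isOpen_hatSector (d α ρ : ℝ) : IsOpen (hatSector d α ρ) :=
  Metric.isOpen_ball.union (isOpen_sector d α)

lemma polar_mem_sector {d α r x : ℝ} (hr : 0 < r) (h1 : d - α / 2 < x) (h2 : x < d + α / 2) :
    polar r x ∈ sector d α := ⟨r, x, hr, h1, h2, rfl⟩

/-- The closed sector of directions `β₁ ≤ x ≤ β₂`, vertex included; in contrast to `sector` it is
given by its bounding directions, and `closedSector x x` is the closed ray in direction `x`. -/
def closedSector (β₁ β₂ : ℝ) : Set ℂ :=
  {s | ∃ r x : ℝ, 0 ≤ r ∧ β₁ ≤ x ∧ x ≤ β₂ ∧ s = polar r x}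

lemma polar_mem_closedSector {β₁ β₂ r x : ℝ} (hr : 0 ≤ r) (h₁ : β₁ ≤ x) (h₂ : x ≤ β₂) :
    polar r x ∈ closedSector β₁ β₂ := ⟨r, x, hr, h₁, h₂, rfl⟩

lemma closedSector_subset {β₁ β₂ γ₁ γ₂ : ℝ} (h₁ : γ₁ ≤ β₁) (h₂ : β₂ ≤ γ₂) :
    closedSector β₁ β₂ ⊆ closedSector γ₁ γ₂ := by
  rintro _ ⟨r, x, hr, hx₁, hx₂, rfl⟩
  exact ⟨r, x, hr, h₁.trans hx₁, hx₂.trans h₂, rfl⟩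

lemma isCompact_closedSector_inter_closedBall (β₁ β₂ R : ℝ) :
    IsCompact (closedSector β₁ β₂ ∩ Metric.closedBall 0 R) := by
  have : closedSector β₁ β₂ ∩ Metric.closedBall 0 R =
      (fun q : ℝ × ℝ => polar q.1 q.2) '' (Icc 0 R ×ˢ Icc β₁ β₂) := by
    ext s
    constructor
    · rintro ⟨⟨r, x, hr, h₁, h₂, rfl⟩, hs⟩
      rw [mem_closedBall_zero_iff, norm_polar hr] at hs
      exact ⟨(r, x), ⟨⟨hr, hs⟩, h₁, h₂⟩, rfl⟩
    · rintro ⟨⟨r, x⟩, ⟨⟨hr, hs⟩, h₁, h₂⟩, rfl⟩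
      exact ⟨⟨r, x, hr, h₁, h₂, rfl⟩, by rwa [mem_closedBall_zero_iff, norm_polar hr]⟩
  rw [this]
  exact (isCompact_Icc.prod isCompact_Icc).image continuous_polar

lemma isClosed_closedSector (β₁ β₂ : ℝ) : IsClosed (closedSector β₁ β₂) := by
  refine isClosed_of_closure_subset fun s hs => ?_
  have hs' := Metric.isOpen_ball.inter_closure
    ⟨mem_ball_zero_iff.2 (lt_add_one ‖s‖), hs⟩
  have hsub : Metric.ball 0 (‖s‖ + 1) ∩ closedSector β₁ β₂ ⊆
      closedSector β₁ β₂ ∩ Metric.closedBall 0 (‖s‖ + 1) :=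
    fun _ h => ⟨h.2, Metric.ball_subset_closedBall h.1⟩
  exact ((isCompact_closedSector_inter_closedBall β₁ β₂ _).isClosed.closure_subset_iff.2 hsub hs').1

lemma polar_notMem_closedSector {β₁ β₂ ρ y : ℝ} (hρ : 0 < ρ)
    (h : ∀ x, β₁ ≤ x → x ≤ β₂ → x ≠ y ∧ |x - y| < 2 * Real.pi) :
    polar ρ y ∉ closedSector β₁ β₂ := by
  rintro ⟨r, x, hr, h₁, h₂, he⟩
  have hr' : 0 < r := by
    rw [← norm_polar hr x, ← he, norm_polar hρ.le]; exact hρ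
  exact polar_ne_polar hr' hρ (h x h₁ h₂).1 (h x h₁ h₂).2 he.symm

lemma neg_polar_notMem_closedSector {β₁ β₂ ρ y : ℝ} (hρ : 0 < ρ) (h₁ : y - Real.pi < β₁)
    (h₂ : β₂ < y + Real.pi) : -polar ρ y ∉ closedSector β₁ β₂ := by
  rw [← polar_add_pi]
  refine polar_notMem_closedSector hρ fun x hx₁ hx₂ => ⟨by linarith, ?_⟩
  rw [abs_lt]; constructor <;> linarith

lemma closedSector_mem_nhds {β₁ β₂ ρ y : ℝ} (hρ : 0 < ρ) (h₁ : β₁ < y) (h₂ : y < β₂) :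
    closedSector β₁ β₂ ∈ 𝓝 (polar ρ y) := by
  refine mem_of_superset ((isOpen_sector ((β₁ + β₂) / 2) (β₂ - β₁)).mem_nhds
    (polar_mem_sector hρ (by linarith) (by linarith))) ?_
  rintro _ ⟨r, x, hr, hx₁, hx₂, rfl⟩
  exact ⟨r, x, hr.le, by linarith, by linarith, rfl⟩

lemma exists_forall_le_norm_sub {S : Set ℂ} (hS : IsClosed S) {p : ℂ} (hp : p ∉ S) :
    ∃ c > 0, ∀ s ∈ S, c ≤ ‖s - p‖ := by
  obtain ⟨c, hc, hsub⟩ := Metric.isOpen_iff.1 hS.isOpen_compl p hp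
  refine ⟨c, hc, fun s hs => le_of_not_gt fun hlt => hsub (mem_ball_iff_norm.2 hlt) hs⟩

/-! ### Functions with polynomial decay -/

/-- `f` is complex differentiable at the points of `S` and `O((1 + |s|)⁻ᵏ)` there: for `k = 2`, the
class of integrands whose integration ray can be rotated inside a closed sector `S`. -/
structure DecaysOn (k : ℕ) (f : ℂ → ℂ) (S : Set ℂ) : Prop where
  differentiableAt : ∀ s ∈ S, DifferentiableAt ℂ f s
  bound : ∃ C, ∀ s ∈ S, ‖f s‖ * (1 + ‖s‖) ^ k ≤ C

namespace DecaysOn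

variable {k l : ℕ} {f g : ℂ → ℂ} {S T : Set ℂ} {p : ℂ}

lemma mono_set (hf : DecaysOn k f S) (h : T ⊆ S) : DecaysOn k f T :=
  ⟨fun s hs => hf.1 s (h hs), hf.2.imp fun _ hC s hs => hC s (h hs)⟩

lemma mono (hf : DecaysOn k f S) (h : l ≤ k) : DecaysOn l f S := by
  refine ⟨hf.1, hf.2.imp fun C hC s hs => le_trans ?_ (hC s hs)⟩
  gcongr
  linarith [norm_nonneg s]

lemma continuousOn (hf : DecaysOn k f S) : ContinuousOn f S :=
  fun s hs => (hf.1 s hs).continuousAt.continuousWithinAt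

lemma const (c : ℂ) (S : Set ℂ) : DecaysOn 0 (fun _ => c) S :=
  ⟨fun _ _ => differentiableAt_const c, ‖c‖, fun _ _ => by rw [pow_zero, mul_one]⟩

lemma add (hf : DecaysOn k f S) (hg : DecaysOn k g S) : DecaysOn k (fun s => f s + g s) S := by
  obtain ⟨A, hA⟩ := hf.2
  obtain ⟨B, hB⟩ := hg.2
  refine ⟨fun s hs => (hf.1 s hs).add (hg.1 s hs), A + B, fun s hs => ?_⟩
  calc ‖f s + g s‖ * (1 + ‖s‖) ^ k ≤ (‖f s‖ + ‖g s‖) * (1 + ‖s‖) ^ k := by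
        gcongr; exact norm_add_le _ _
    _ ≤ A + B := by rw [add_mul]; exact add_le_add (hA s hs) (hB s hs)

lemma mul (hf : DecaysOn k f S) (hg : DecaysOn l g S) :
    DecaysOn (k + l) (fun s => f s * g s) S := by
  obtain ⟨A, hA⟩ := hf.2
  obtain ⟨B, hB⟩ := hg.2
  refine ⟨fun s hs => (hf.1 s hs).mul (hg.1 s hs), A * B, fun s hs => ?_⟩
  have hA₀ : 0 ≤ A := le_trans (by positivity) (hA s hs)
  calc ‖f s * g s‖ * (1 + ‖s‖) ^ (k + l)
      = (‖f s‖ * (1 + ‖s‖) ^ k) * (‖g s‖ * (1 + ‖s‖) ^ l) := by rw [norm_mul, pow_add]; ring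
    _ ≤ A * B := mul_le_mul (hA s hs) (hB s hs) (by positivity) hA₀

lemma const_mul (c : ℂ) (hf : DecaysOn k f S) : DecaysOn k (fun s => c * f s) S := by
  simpa only [zero_add] using (const c S).mul hf

lemma sub (hf : DecaysOn k f S) (hg : DecaysOn k g S) : DecaysOn k (fun s => f s - g s) S := by
  simpa only [sub_eq_add_neg, neg_one_mul] using hf.add (hg.const_mul (-1))

lemma union (hf : DecaysOn k f S) (hf' : DecaysOn k f T) : DecaysOn k f (S ∪ T) := by
  obtain ⟨A, hA⟩ := hf.2
  obtain ⟨B, hB⟩ := hf'.2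
  exact ⟨fun s hs => hs.elim (hf.1 s) (hf'.1 s), max A B, fun s hs =>
    hs.elim (fun h => (hA s h).trans (le_max_left A B)) fun h => (hB s h).trans (le_max_right A B)⟩

lemma of_isCompact (hS : IsCompact S) (hf : ∀ s ∈ S, DifferentiableAt ℂ f s) (k : ℕ) :
    DecaysOn k f S := by
  have hc : ContinuousOn (fun s => ‖f s‖ * (1 + ‖s‖) ^ k) S :=
    (ContinuousOn.norm fun s hs => (hf s hs).continuousAt.continuousWithinAt).mul (by fun_prop)
  obtain ⟨C, hC⟩ := (hS.image_of_continuousOn hc).bddAbove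
  exact ⟨hf, C, fun s hs => hC (mem_image_of_mem _ hs)⟩

lemma inv_sub (hS : IsClosed S) (hp : p ∉ S) : DecaysOn 1 (fun s => (s - p)⁻¹) S := by
  obtain ⟨c, hc, hcS⟩ := exists_forall_le_norm_sub hS hp
  refine ⟨fun s hs => ?_, (1 + ‖p‖) / c + 1, fun s hs => ?_⟩
  · have : s - p ≠ 0 := sub_ne_zero.2 fun h => hp (h ▸ hs)
    fun_prop (disch := assumption)
  · have hpos : 0 < ‖s - p‖ := hc.trans_le (hcS s hs)
    rw [norm_inv, pow_one, inv_mul_le_iff₀ hpos]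
    have h₁ : 1 + ‖p‖ ≤ ‖s - p‖ * ((1 + ‖p‖) / c) := by
      rw [mul_div_assoc', le_div_iff₀ hc, mul_comm]
      exact mul_le_mul_of_nonneg_right (hcS s hs) (by positivity)
    linarith [norm_le_norm_add_norm_sub' s p]

lemma inv_sub_pow (hS : IsClosed S) (hp : p ∉ S) (n : ℕ) :
    DecaysOn n (fun s => ((s - p) ^ n)⁻¹) S := by
  induction n with
  | zero => simpa using const 1 S
  | succ n ih => simpa only [pow_succ, mul_inv] using ih.mul (inv_sub hS hp)

protected lemma dslope (hS : IsClosed S) (hp : S ∈ 𝓝 p)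
    (hk : DecaysOn k (fun s => f s - f p) S) : DecaysOn (k + 1) (dslope f p) S := by
  have hf : ∀ s ∈ S, DifferentiableAt ℂ f s :=
    fun s hs => by simpa using (hk.1 s hs).add_const (f p)
  have hd : ∀ s ∈ S, DifferentiableAt ℂ (dslope f p) s := by
    intro s hs
    rcases eq_or_ne s p with rfl | hsp
    · obtain ⟨P, hP⟩ := DifferentiableOn.analyticAt
        (fun w hw => (hf w hw).differentiableWithinAt) hp
      exact hP.has_fpower_series_dslope_fslope.analyticAt.differentiableAt
    · exact (differentiableAt_dslope_of_ne hsp).2 (hf s hs)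
  have hfar : DecaysOn (k + 1) (dslope f p) (S \ Metric.ball p 1) := by
    have h := (hk.mono_set sdiff_subset).mul
      (inv_sub (hS.sdiff Metric.isOpen_ball) (fun h => h.2 (Metric.mem_ball_self one_pos) :
        p ∉ S \ Metric.ball p 1))
    refine ⟨fun s hs => hd s hs.1, h.2.imp fun C hC s hs => ?_⟩
    have hsp : s ≠ p := fun h => hs.2 (h ▸ Metric.mem_ball_self one_pos)
    rw [dslope_of_ne f hsp, slope_def_field, div_eq_mul_inv]
    exact hC s hs
  have hnear : DecaysOn (k + 1) (dslope f p) (S ∩ Metric.closedBall p 1) :=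
    of_isCompact ((isCompact_closedBall p 1).inter_left hS) (fun s hs => hd s hs.1) _
  refine (hfar.union hnear).mono_set fun s hs => ?_
  by_cases h : s ∈ Metric.ball p 1
  · exact .inr ⟨hs, Metric.ball_subset_closedBall h⟩
  · exact .inl ⟨hs, h⟩

end DecaysOn

/-! ### Power series -/

section PowerSeries

variable {f : ℂ → ℂ} {x : ℂ} {c : ℕ → ℂ}

lemma hasFPowerSeriesAt_ofScalars
    (h : ∀ᶠ w in 𝓝 (0 : ℂ), HasSum (fun n : ℕ => c n * w ^ n) (f (x + w))) :
    HasFPowerSeriesAt f (FormalMultilinearSeries.ofScalars ℂ c) x := by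
  rw [hasFPowerSeriesAt_iff]
  simpa [FormalMultilinearSeries.coeff_ofScalars, mul_comm] using h

lemma coeff_eq_iteratedDeriv
    (h : ∀ᶠ w in 𝓝 (0 : ℂ), HasSum (fun n : ℕ => c n * w ^ n) (f (x + w))) (n : ℕ) :
    c n = iteratedDeriv n f x / n.factorial := by
  have h₁ := hasFPowerSeriesAt_ofScalars h
  have h₂ := congrArg (fun q => FormalMultilinearSeries.coeff q n)
    (h₁.eq_formalMultilinearSeries h₁.analyticAt.hasFPowerSeriesAt)
  simpa [FormalMultilinearSeries.coeff_ofScalars] using h₂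

lemma hasSum_taylor {w : ℂ} {ρ : ℝ} (hf : DifferentiableOn ℂ f (Metric.ball x ρ)) (hw : ‖w‖ < ρ) :
    HasSum (fun n : ℕ => iteratedDeriv n f x / n.factorial * w ^ n) (f (x + w)) := by
  have := Complex.hasSum_taylorSeries_on_ball hf (z := x + w) (by simpa using hw)
  convert! this using 2 with n
  simp only [add_sub_cancel_left, smul_eq_mul]
  ring

lemma iteratedDeriv_dslope_div_factorial (hf : AnalyticAt ℂ f x) (n : ℕ) :
    iteratedDeriv n (dslope f x) x / n.factorial =
      iteratedDeriv (n + 1) f x / (n + 1).factorial := by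
  obtain ⟨P, hP⟩ := hf
  have hcoeff : ∀ {g : ℂ → ℂ} {Q : FormalMultilinearSeries ℂ ℂ ℂ}, HasFPowerSeriesAt g Q x →
      ∀ m, Q.coeff m = iteratedDeriv m g x / m.factorial := fun hQ m =>
    coeff_eq_iteratedDeriv (by simpa [mul_comm] using (hasFPowerSeriesAt_iff.1 hQ)) m
  rw [← hcoeff hP, ← hcoeff hP.has_fpower_series_dslope_fslope,
    FormalMultilinearSeries.coeff_fslope]

end PowerSeries

/-! ### Principal parts -/

/-- The coefficient sequences of entire functions, that is, of principal parts that converge off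
their pole. -/
def RapidDecay (b : ℕ → ℂ) : Prop := ∀ M : ℝ, 0 ≤ M → Summable fun n : ℕ => ‖b n‖ * M ^ n

/-- The principal part at `p` with the coefficients `b n` of `(s - p)⁻⁽ⁿ⁺¹⁾`. -/
def principalPart (b : ℕ → ℂ) (p s : ℂ) : ℂ := ∑' n : ℕ, b n / (s - p) ^ (n + 1)

lemma principalPart_add (b : ℕ → ℂ) (p z s : ℂ) :
    principalPart b p (z + s) = principalPart b (p - z) s := by
  simp only [principalPart, show z + s - p = s - (p - z) by ring]

lemma principalPart_eq_inv_mul (b : ℕ → ℂ) (p s : ℂ) :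
    principalPart b p s = (s - p)⁻¹ * ∑' n : ℕ, b n * (s - p)⁻¹ ^ n := by
  rw [principalPart, ← tsum_mul_left]
  exact tsum_congr fun n => by rw [div_eq_mul_inv, inv_pow, pow_succ, mul_inv]; ring

lemma norm_div_pow_le {b p s : ℂ} {c : ℝ} (hc : 0 < c) (hs : c ≤ ‖s - p‖) (n : ℕ) :
    ‖b / (s - p) ^ (n + 1)‖ ≤ ‖b‖ * c⁻¹ ^ n * c⁻¹ := by
  rw [norm_div, norm_pow, div_eq_mul_inv, ← inv_pow, mul_assoc, ← pow_succ]
  gcongr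

namespace RapidDecay

variable {b : ℕ → ℂ} {p s : ℂ} {c : ℝ}

lemma summable_mul_pow (hb : RapidDecay b) (w : ℂ) : Summable fun n : ℕ => b n * w ^ n :=
  Summable.of_norm (by simpa only [norm_mul, norm_pow] using hb _ (norm_nonneg w))

lemma differentiable_tsum (hb : RapidDecay b) : Differentiable ℂ fun w => ∑' n, b n * w ^ n := by
  intro w
  have h : DifferentiableOn ℂ (fun w => ∑' n, b n * w ^ n) (Metric.ball 0 (‖w‖ + 1)) := by
    refine Complex.differentiableOn_tsum_of_summable_norm (hb (‖w‖ + 1) (by positivity))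
      (fun n => by fun_prop) Metric.isOpen_ball fun n v hv => ?_
    rw [norm_mul, norm_pow]
    gcongr
    exact (mem_ball_zero_iff.1 hv).le
  exact h.differentiableAt (Metric.isOpen_ball.mem_nhds (mem_ball_zero_iff.2 (lt_add_one _)))

lemma differentiableAt (hb : RapidDecay b) (hs : s ≠ p) :
    DifferentiableAt ℂ (principalPart b p) s := by
  have hinv : DifferentiableAt ℂ (fun s => (s - p)⁻¹) s := by
    have := sub_ne_zero.2 hs
    fun_prop (disch := assumption)
  rw [funext (principalPart_eq_inv_mul b p)]
  exact hinv.mul ((hb.differentiable_tsum _).comp s hinv)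

lemma tendstoLocallyUniformlyOn (hb : RapidDecay b) (p : ℂ) :
    TendstoLocallyUniformlyOn (fun (N : ℕ) s => ∑ n ∈ Finset.range N, b n / (s - p) ^ (n + 1))
      (principalPart b p) atTop {p}ᶜ := by
  rw [tendstoLocallyUniformlyOn_iff_forall_isCompact isOpen_compl_singleton]
  intro K hKp hK
  obtain ⟨c, hc, hcK⟩ := exists_forall_le_norm_sub hK.isClosed fun h => hKp h rfl
  exact tendstoUniformlyOn_tsum_nat ((hb _ (inv_nonneg.2 hc.le)).mul_right c⁻¹)
    fun n s hs => norm_div_pow_le hc (hcK s hs) n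

lemma exists_bound (hb : RapidDecay b) (hc : 0 < c) :
    ∃ B : ℝ, 0 < B ∧ ∀ p s : ℂ, c ≤ ‖s - p‖ → ‖principalPart b p s‖ ≤ B := by
  have h := (hb _ (inv_nonneg.2 hc.le)).mul_right c⁻¹
  refine ⟨∑' n : ℕ, ‖b n‖ * c⁻¹ ^ n * c⁻¹ + 1, ?_, fun p s hs => ?_⟩
  · have : 0 ≤ ∑' n : ℕ, ‖b n‖ * c⁻¹ ^ n * c⁻¹ := tsum_nonneg fun n => by positivity
    linarith
  · exact (tsum_of_norm_bounded h.hasSum fun n => norm_div_pow_le hc hs n).trans (by linarith)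

/-- Read at `w = (s - p)⁻¹`, the principal part is `w * ∑ b n * w ^ n`: an entire function, which
is constant by Liouville. -/
lemma eq_zero_of_bounded (hb : RapidDecay b) {B : ℝ} (hc : 0 < c)
    (h : ∀ s : ℂ, s ≠ p → ‖s - p‖ < c → ‖principalPart b p s‖ ≤ B) : b = 0 := by
  set E : ℂ → ℂ := fun w => ∑' n, b n * w ^ n
  have hpp : ∀ w, w * E w = principalPart b p (p + w⁻¹) := fun w => by
    rw [principalPart_eq_inv_mul, add_sub_cancel_left, inv_inv]
  obtain ⟨B', -, hB'⟩ := hb.exists_bound hc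
  have hbdd : Bornology.IsBounded (range fun w => w * E w) := by
    rw [isBounded_iff_forall_norm_le]
    refine ⟨max 0 (max B B'), ?_⟩
    rintro _ ⟨w, rfl⟩
    rcases eq_or_ne w 0 with rfl | hw
    · simp
    simp only [hpp]
    rcases lt_or_ge ‖w⁻¹‖ c with hlt | hge
    · exact (h _ (by simpa using hw) (by simpa using hlt)).trans (by simp)
    · exact (hB' _ _ (by simpa using hge)).trans (by simp)
  have hmul : ∀ w, w * E w = 0 := fun w => by
    simpa using (differentiable_id.mul hb.differentiable_tsum).apply_eq_apply_of_bounded hbdd w 0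
  have hE₀ : E = 0 := (hb.differentiable_tsum.continuous).ext_on (dense_compl_singleton 0)
    continuous_zero fun w hw => (mul_eq_zero.1 (hmul w)).resolve_left hw
  ext n
  rw [coeff_eq_iteratedDeriv (c := b) (f := E) (x := 0) (.of_forall fun w => by
    rw [zero_add]; exact (hb.summable_mul_pow w).hasSum) n, hE₀]
  simp

end RapidDecay

/-- The sum of the series in `w = (z - p)⁻¹` is entire, so the series converges for all `w`. -/
lemma rapidDecay_and_eq_principalPart {c : ℕ → ℂ} {f : ℂ → ℂ} {p : ℂ}
    (hf : DifferentiableOn ℂ f {p}ᶜ)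
    (h : ∀ z : ℂ, 1 ≤ ‖z - p‖ → HasSum (fun n : ℕ => c n / (z - p) ^ (n + 1)) (f z)) :
    RapidDecay c ∧ ∀ z : ℂ, z ≠ p → f z = principalPart c p z := by
  set g : ℂ → ℂ := fun w => if w = 0 then c 0 else w⁻¹ * f (p + w⁻¹)
  have hg₀ : g 0 = c 0 := if_pos rfl
  have hg₁ : ∀ w ≠ 0, g w = w⁻¹ * f (p + w⁻¹) := fun w hw => if_neg hw
  have hnear : ∀ᶠ w in 𝓝 (0 : ℂ), HasSum (fun n : ℕ => c n * w ^ n) (g (0 + w)) := by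
    filter_upwards [Metric.ball_mem_nhds (0 : ℂ) one_pos] with w hw
    rw [zero_add]
    rcases eq_or_ne w 0 with rfl | hw₀
    · rw [hg₀]
      simpa using hasSum_single (f := fun n => c n * 0 ^ n) 0 fun n hn => by simp [hn]
    · have hle : 1 ≤ ‖p + w⁻¹ - p‖ := by
        rw [add_sub_cancel_left, norm_inv]
        exact (one_le_inv₀ (norm_pos_iff.2 hw₀)).2 (mem_ball_zero_iff.1 hw).le
      rw [hg₁ w hw₀]
      convert! (h _ hle).mul_left w⁻¹ using 2 with n
      rw [add_sub_cancel_left, inv_pow, div_inv_eq_mul]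
      field_simp
      ring
  have hgd : Differentiable ℂ g := by
    intro w
    rcases eq_or_ne w 0 with rfl | hw₀
    · exact (hasFPowerSeriesAt_ofScalars hnear).analyticAt.differentiableAt
    · have hd : DifferentiableAt ℂ (fun w : ℂ => w⁻¹ * f (p + w⁻¹)) w :=
        (differentiableAt_inv hw₀).mul (DifferentiableAt.comp w
          (hf.differentiableAt (isOpen_compl_singleton.mem_nhds (by simpa using hw₀)))
          ((differentiableAt_const p).add (differentiableAt_inv hw₀)))
      refine hd.congr_of_eventuallyEq ?_
      filter_upwards [isOpen_ne.mem_nhds hw₀] with v hv using hg₁ v hv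
  have hall : ∀ w : ℂ, HasSum (fun n : ℕ => c n * w ^ n) (g w) := fun w => by
    simpa only [zero_add, ← coeff_eq_iteratedDeriv hnear] using
      hasSum_taylor (x := 0) hgd.differentiableOn (lt_add_one ‖w‖)
  refine ⟨fun M hM => (hall M).summable.norm.congr fun n => ?_, fun z hz => ?_⟩
  · rw [norm_mul, norm_pow, Complex.norm_real, Real.norm_of_nonneg hM]
  · have hz' : z - p ≠ 0 := sub_ne_zero.2 hz
    rw [principalPart_eq_inv_mul, (hall _).tsum_eq, hg₁ _ (inv_ne_zero hz'), inv_inv,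
      add_sub_cancel, inv_mul_cancel_left₀ hz']

/-! ### Integrals along half-lines -/

lemma DecaysOn.exists_norm_le {f : ℂ → ℂ} {S : Set ℂ} (hf : DecaysOn 2 f S) :
    ∃ C, ∀ s ∈ S, ‖f s‖ ≤ C * (1 + ‖s‖ ^ 2)⁻¹ := by
  obtain ⟨C, hC⟩ := hf.2
  refine ⟨C, fun s hs => ?_⟩
  rw [← div_eq_mul_inv, le_div_iff₀ (by positivity)]
  refine le_trans ?_ (hC s hs)
  gcongr
  nlinarith [norm_nonneg s]

lemma continuousOn_comp_polar {f : ℂ → ℂ} {x : ℝ} (hf : ContinuousOn f (closedSector x x)) :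
    ContinuousOn (fun r => f (polar r x)) (Ioi 0) :=
  hf.comp (continuous_polar_left x).continuousOn
    fun _ hr => polar_mem_closedSector (mem_Ioi.1 hr).le le_rfl le_rfl

lemma DecaysOn.integrableOn {f : ℂ → ℂ} {x : ℝ} (hf : DecaysOn 2 f (closedSector x x)) :
    IntegrableOn (fun r => f (polar r x)) (Ioi 0) := by
  obtain ⟨C, hC⟩ := hf.exists_norm_le
  refine (integrable_inv_one_add_sq.const_mul C).integrableOn.mono'
    ((continuousOn_comp_polar hf.continuousOn).aestronglyMeasurable measurableSet_Ioi)
    ((ae_restrict_iff' measurableSet_Ioi).2 (.of_forall fun r hr => ?_))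
  have hr₀ : 0 ≤ r := (mem_Ioi.1 hr).le
  simpa only [norm_polar hr₀] using hC _ (polar_mem_closedSector hr₀ le_rfl le_rfl)

section RayIntegral

variable {f g : ℂ → ℂ} {x : ℝ}

lemma rayIntegral_add (hf : IntegrableOn (fun r => f (polar r x)) (Ioi 0))
    (hg : IntegrableOn (fun r => g (polar r x)) (Ioi 0)) :
    rayIntegral (fun s => f s + g s) x = rayIntegral f x + rayIntegral g x := by
  simp only [rayIntegral, add_mul]
  exact integral_add (hf.mul_const _) (hg.mul_const _)

lemma rayIntegral_const_mul (c : ℂ) (f : ℂ → ℂ) (x : ℝ) :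
    rayIntegral (fun s => c * f s) x = c * rayIntegral f x := by
  simp only [rayIntegral, mul_assoc]
  exact integral_const_mul _ _

lemma rayIntegral_congr (h : ∀ r : ℝ, 0 < r → f (polar r x) = g (polar r x)) :
    rayIntegral f x = rayIntegral g x :=
  setIntegral_congr_fun measurableSet_Ioi fun r hr => by simp only [h r hr]

lemma abs_exp_smul_eq (f : ℂ → ℂ) (x u : ℝ) :
    |Real.exp u| • (f (polar (Real.exp u) x) * Complex.exp (Complex.I * x)) =
      f (Complex.exp (u + x * Complex.I)) * Complex.exp (u + x * Complex.I) := by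
  have h : Complex.exp (u + x * Complex.I) = polar (Real.exp u) x := by
    rw [exp_eq_polar]; simp
  rw [h, abs_of_pos (Real.exp_pos u), Complex.real_smul, polar]
  ring

lemma rayIntegral_eq_integral_exp (f : ℂ → ℂ) (x : ℝ) :
    rayIntegral f x =
      ∫ u : ℝ, f (Complex.exp (u + x * Complex.I)) * Complex.exp (u + x * Complex.I) := by
  rw [rayIntegral, ← Real.range_exp, ← image_univ,
    integral_image_eq_integral_abs_deriv_smul MeasurableSet.univ
    (fun u _ => (Real.hasDerivAt_exp u).hasDerivWithinAt) Real.exp_injective.injOn,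
    Measure.restrict_univ]
  exact integral_congr_ae (.of_forall (abs_exp_smul_eq f x))

lemma integrable_exp_of_integrableOn (h : IntegrableOn (fun r => f (polar r x)) (Ioi 0)) :
    Integrable fun u : ℝ =>
      f (Complex.exp (u + x * Complex.I)) * Complex.exp (u + x * Complex.I) := by
  have h₁ : IntegrableOn (fun r => f (polar r x) * Complex.exp (Complex.I * x)) (Ioi 0) :=
    h.mul_const _
  rw [← Real.range_exp, ← image_univ,
    integrableOn_image_iff_integrableOn_abs_deriv_smul MeasurableSet.univ
    (fun u _ => (Real.hasDerivAt_exp u).hasDerivWithinAt) Real.exp_injective.injOn,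
    integrableOn_univ] at h₁
  exact h₁.congr (.of_forall (abs_exp_smul_eq f x))

end RayIntegral

lemma integral_horizontal_eq {F : ℂ → ℂ} {a b : ℝ} (hab : a ≤ b) {B : ℝ → ℝ}
    (hd : ∀ w : ℂ, w.im ∈ Icc a b → DifferentiableAt ℂ F w)
    (hB : ∀ w : ℂ, w.im ∈ Icc a b → ‖F w‖ ≤ B w.re)
    (hBtop : Tendsto B atTop (𝓝 0)) (hBbot : Tendsto B atBot (𝓝 0))
    (ha : Integrable fun u : ℝ => F (u + a * Complex.I))
    (hb : Integrable fun u : ℝ => F (u + b * Complex.I)) :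
    ∫ u : ℝ, F (u + a * Complex.I) = ∫ u : ℝ, F (u + b * Complex.I) := by
  have hhor : ∀ {y : ℝ}, (Integrable fun u : ℝ => F (u + y * Complex.I)) →
      Tendsto (fun T : ℝ => ∫ u in (-T)..T, F (u + y * Complex.I)) atTop
        (𝓝 (∫ u : ℝ, F (u + y * Complex.I))) := fun h =>
    intervalIntegral_tendsto_integral h tendsto_neg_atTop_atBot tendsto_id
  have hvert : ∀ T : ℝ, ‖∫ y in a..b, F (T + y * Complex.I)‖ ≤ B T * |b - a| := fun T => by
    refine intervalIntegral.norm_integral_le_of_norm_le_const fun y hy => ?_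
    rw [uIoc_of_le hab] at hy
    simpa using hB (T + y * Complex.I) (by simpa using Ioc_subset_Icc_self hy)
  have hright : Tendsto (fun T : ℝ => ∫ y in a..b, F (T + y * Complex.I)) atTop (𝓝 0) :=
    squeeze_zero_norm hvert (by simpa using hBtop.mul_const |b - a|)
  have hleft : Tendsto (fun T : ℝ => ∫ y in a..b, F ((-T : ℝ) + y * Complex.I)) atTop (𝓝 0) :=
    squeeze_zero_norm (fun T => hvert (-T))
      (by simpa using (hBbot.comp tendsto_neg_atTop_atBot).mul_const |b - a|)
  have hrect : ∀ T : ℝ, (∫ u in (-T)..T, F (u + a * Complex.I)) -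
      (∫ u in (-T)..T, F (u + b * Complex.I)) +
      Complex.I • (∫ y in a..b, F (T + y * Complex.I)) -
      Complex.I • ∫ y in a..b, F ((-T : ℝ) + y * Complex.I) = 0 := by
    intro T
    have hdiff : DifferentiableOn ℂ F (uIcc (-T) T ×ℂ uIcc a b) := fun w hw =>
      (hd w (by simpa [uIcc_of_le hab] using hw.2)).differentiableWithinAt
    simpa using Complex.integral_boundary_rect_eq_zero_of_differentiableOn F
      ((-T : ℝ) + a * Complex.I) (T + b * Complex.I) (by simpa using hdiff)
  have hlim := (((hhor ha).sub (hhor hb)).add (hright.const_smul Complex.I)).sub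
    (hleft.const_smul Complex.I)
  simp only [hrect, smul_zero, add_zero, sub_zero] at hlim
  exact sub_eq_zero.1 (tendsto_nhds_unique hlim tendsto_const_nhds)

lemma tendsto_inv_exp_add_exp_neg :
    Tendsto (fun u : ℝ => (Real.exp u + Real.exp (-u))⁻¹) atTop (𝓝 0) ∧
      Tendsto (fun u : ℝ => (Real.exp u + Real.exp (-u))⁻¹) atBot (𝓝 0) := by
  constructor <;> refine tendsto_inv_atTop_zero.comp ?_
  · exact tendsto_atTop_mono (fun u => le_add_of_nonneg_right (Real.exp_pos _).le)
      Real.tendsto_exp_atTop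
  · exact tendsto_atTop_mono (fun u => le_add_of_nonneg_left (Real.exp_pos _).le)
      (Real.tendsto_exp_atTop.comp tendsto_neg_atBot_atTop)

lemma exp_mul_inv_one_add_sq (u : ℝ) :
    (1 + Real.exp u ^ 2)⁻¹ * Real.exp u = (Real.exp u + Real.exp (-u))⁻¹ := by
  rw [Real.exp_neg]
  have := Real.exp_pos u
  field_simp
  ring

/-- After `s = exp w` the closed sector becomes a horizontal strip. -/
lemma rayIntegral_eq_of_decaysOn {f : ℂ → ℂ} {β₁ β₂ x₁ x₂ : ℝ} (h₁ : x₁ ∈ Icc β₁ β₂)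
    (h₂ : x₂ ∈ Icc β₁ β₂) (hf : DecaysOn 2 f (closedSector β₁ β₂)) :
    rayIntegral f x₁ = rayIntegral f x₂ := by
  wlog hx : x₁ ≤ x₂ generalizing x₁ x₂
  · exact (this h₂ h₁ (le_of_not_ge hx)).symm
  obtain ⟨C, hC⟩ := hf.exists_norm_le
  have hmem : ∀ w : ℂ, w.im ∈ Icc x₁ x₂ → Complex.exp w ∈ closedSector β₁ β₂ := fun w hw => by
    rw [exp_eq_polar]
    exact polar_mem_closedSector (Real.exp_pos _).le (h₁.1.trans hw.1) (hw.2.trans h₂.2)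
  have hint : ∀ x ∈ Icc β₁ β₂, Integrable fun u : ℝ =>
      f (Complex.exp (u + x * Complex.I)) * Complex.exp (u + x * Complex.I) := fun x hx =>
    integrable_exp_of_integrableOn (hf.mono_set (closedSector_subset hx.1 hx.2)).integrableOn
  rw [rayIntegral_eq_integral_exp, rayIntegral_eq_integral_exp]
  refine integral_horizontal_eq (F := fun w => f (Complex.exp w) * Complex.exp w)
    (B := fun u => C * (Real.exp u + Real.exp (-u))⁻¹) hx (fun w hw => ?_) (fun w hw => ?_)
    (by simpa using tendsto_inv_exp_add_exp_neg.1.const_mul C)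
    (by simpa using tendsto_inv_exp_add_exp_neg.2.const_mul C) (hint x₁ h₁) (hint x₂ h₂)
  · exact ((hf.1 _ (hmem w hw)).comp w Complex.differentiableAt_exp).mul
      Complex.differentiableAt_exp
  · have h := hC _ (hmem w hw)
    rw [Complex.norm_exp] at h
    rw [norm_mul, Complex.norm_exp, ← exp_mul_inv_one_add_sq, ← mul_assoc]
    gcongr

lemma DecaysOn.tendsto_zero {f : ℂ → ℂ} {x : ℝ} (hf : DecaysOn 1 f (closedSector x x)) :
    Tendsto (fun r => f (polar r x)) atTop (𝓝 0) := by
  obtain ⟨C, hC⟩ := hf.2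
  refine squeeze_zero_norm' (a := fun r => C * (1 + r)⁻¹) ?_ ?_
  · filter_upwards [eventually_ge_atTop 0] with r hr
    have h := hC _ (polar_mem_closedSector hr le_rfl le_rfl)
    rw [norm_polar hr, pow_one] at h
    rwa [← div_eq_mul_inv, le_div_iff₀ (by positivity)]
  · simpa using (tendsto_inv_atTop_zero.comp
      (tendsto_atTop_add_const_left atTop 1 tendsto_id)).const_mul C

lemma rayIntegral_inv_sub_pow {p : ℂ} {x : ℝ} (hp : p ∉ closedSector x x) (n : ℕ) :
    rayIntegral (fun s => ((s - p) ^ (n + 2))⁻¹) x = ((n + 1) * (-p) ^ (n + 1))⁻¹ := by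
  have hdecay := fun m => DecaysOn.inv_sub_pow (isClosed_closedSector x x) hp m
  have hderiv : ∀ r ∈ Ici (0 : ℝ), HasDerivAt
      (fun r => -(n + 1 : ℂ)⁻¹ * ((polar r x - p) ^ (n + 1))⁻¹)
      (((polar r x - p) ^ (n + 2))⁻¹ * Complex.exp (Complex.I * x)) r := by
    intro r hr
    have hne : polar r x - p ≠ 0 :=
      sub_ne_zero.2 fun h => hp (h ▸ polar_mem_closedSector hr le_rfl le_rfl)
    convert! ((((hasDerivAt_polar r x).sub_const p).fun_pow (n + 1)).inv
      (pow_ne_zero _ hne)).const_mul (-(n + 1 : ℂ)⁻¹) using 1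
    have : (n + 1 : ℂ) ≠ 0 := by exact_mod_cast n.succ_ne_zero
    simp only [add_tsub_cancel_right, Nat.cast_add, Nat.cast_one]
    field_simp
    ring
  have hlim := ((hdecay (n + 1)).mono (Nat.le_add_left 1 n)).tendsto_zero.const_mul
    (-(n + 1 : ℂ)⁻¹)
  rw [mul_zero] at hlim
  rw [rayIntegral, integral_Ioi_of_hasDerivAt_of_tendsto' hderiv
    (((hdecay (n + 2)).mono (Nat.le_add_left 2 n)).integrableOn.mul_const _) hlim, polar_zero,
    zero_sub, zero_sub, neg_mul, neg_neg, mul_inv]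

/-! ### The jump of a Cauchy type integral -/

/-- The Cauchy kernel at `p`, corrected by a second pole at `-p` so that it is integrable at
infinity. -/
def cauchyKernel (p s : ℂ) : ℂ := 2 * p * ((s - p)⁻¹ * (s - -p)⁻¹)

lemma decaysOn_cauchyKernel {S : Set ℂ} (hS : IsClosed S) {p : ℂ} (hp : p ∉ S) (hp' : -p ∉ S) :
    DecaysOn 2 (cauchyKernel p) S :=
  ((DecaysOn.inv_sub hS hp).mul (DecaysOn.inv_sub hS hp')).const_mul (2 * p)

lemma integral_inv_one_add_inv_mul_sq {ρ : ℝ} (hρ : 0 < ρ) :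
    ∫ r in Ioi (0 : ℝ), (1 + (ρ⁻¹ * r) ^ 2)⁻¹ = ρ * (Real.pi / 2) := by
  rw [integral_comp_mul_left_Ioi (fun r => (1 + r ^ 2)⁻¹) 0 (inv_pos.2 hρ), mul_zero,
    integral_Ioi_inv_one_add_sq, Real.arctan_zero, sub_zero, inv_inv, smul_eq_mul]

section Jump

variable {ρ x y : ℝ}

lemma rayIntegral_cauchyKernel_of_perpendicular (hρ : 0 < ρ) {c : ℂ} (hc : c ^ 2 = -1)
    (hx : Complex.exp (Complex.I * x) = c * Complex.exp (Complex.I * y)) :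
    rayIntegral (cauchyKernel (polar ρ y)) x = -(c * Real.pi) := by
  have hintegrand : ∀ r : ℝ, cauchyKernel (polar ρ y) (polar r x) * Complex.exp (Complex.I * x) =
      -(2 * c * (ρ : ℂ)⁻¹) * ((1 + (ρ⁻¹ * r) ^ 2)⁻¹ : ℝ) := by
    intro r
    have hρ' : (ρ : ℂ) ≠ 0 := Complex.ofReal_ne_zero.2 hρ.ne'
    have hden : (ρ : ℂ) ^ 2 + r ^ 2 ≠ 0 := by
      exact_mod_cast (by positivity : ρ ^ 2 + r ^ 2 ≠ 0)
    have he := Complex.exp_ne_zero (Complex.I * y)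
    have hprod : (r * (c * Complex.exp (Complex.I * y)) - ρ * Complex.exp (Complex.I * y)) *
        (r * (c * Complex.exp (Complex.I * y)) - -(ρ * Complex.exp (Complex.I * y))) =
        -(Complex.exp (Complex.I * y) ^ 2 * (ρ ^ 2 + r ^ 2)) := by
      linear_combination (r * Complex.exp (Complex.I * y)) ^ 2 * hc
    rw [cauchyKernel, polar, polar, hx, ← mul_inv, hprod]
    push_cast
    field_simp
  simp only [rayIntegral, hintegrand]
  rw [integral_const_mul, integral_complex_ofReal, integral_inv_one_add_inv_mul_sq hρ]
  have hρ' : (ρ : ℂ) ≠ 0 := Complex.ofReal_ne_zero.2 hρ.ne'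
  push_cast
  field_simp

lemma rayIntegral_cauchyKernel_eq (hρ : 0 < ρ) {x' : ℝ}
    (h : ∀ β ∈ uIcc x x', β ≠ y ∧ |β - y| < Real.pi) :
    rayIntegral (cauchyKernel (polar ρ y)) x = rayIntegral (cauchyKernel (polar ρ y)) x' := by
  refine rayIntegral_eq_of_decaysOn (β₁ := min x x') (β₂ := max x x')
    ⟨min_le_left _ _, le_max_left _ _⟩ ⟨min_le_right _ _, le_max_right _ _⟩
    (decaysOn_cauchyKernel (isClosed_closedSector _ _) ?_ ?_)
  · exact polar_notMem_closedSector hρ fun β h₁ h₂ =>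
      ⟨(h β ⟨h₁, h₂⟩).1, (h β ⟨h₁, h₂⟩).2.trans (by linarith [Real.pi_pos])⟩
  · refine neg_polar_notMem_closedSector hρ ?_ ?_
    · linarith [(abs_lt.1 (h _ ⟨le_rfl, min_le_max⟩).2).1]
    · linarith [(abs_lt.1 (h _ ⟨min_le_max, le_rfl⟩).2).2]

lemma rayIntegral_cauchyKernel_of_gt (hρ : 0 < ρ) (h₁ : y < x) (h₂ : x < y + Real.pi) :
    rayIntegral (cauchyKernel (polar ρ y)) x = -(Real.pi * Complex.I) := by
  rw [rayIntegral_cauchyKernel_eq hρ (x' := y + Real.pi / 2),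
    rayIntegral_cauchyKernel_of_perpendicular hρ Complex.I_sq, mul_comm Complex.I]
  · push_cast
    rw [mul_add, Complex.exp_add, mul_comm Complex.I (Real.pi / 2 : ℂ),
      Complex.exp_pi_div_two_mul_I, mul_comm]
  · intro β hβ
    have hlt : y < β := (lt_min h₁ (by linarith [Real.pi_pos])).trans_le hβ.1
    have hgt : β < y + Real.pi := hβ.2.trans_lt (max_lt h₂ (by linarith [Real.pi_pos]))
    exact ⟨hlt.ne', abs_lt.2 ⟨by linarith [Real.pi_pos], by linarith⟩⟩

lemma rayIntegral_cauchyKernel_of_lt (hρ : 0 < ρ) (h₁ : y - Real.pi < x) (h₂ : x < y) :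
    rayIntegral (cauchyKernel (polar ρ y)) x = Real.pi * Complex.I := by
  rw [rayIntegral_cauchyKernel_eq hρ (x' := y - Real.pi / 2),
    rayIntegral_cauchyKernel_of_perpendicular hρ (c := -Complex.I) (by simp), neg_mul, neg_neg,
    mul_comm]
  · push_cast
    rw [sub_eq_add_neg, mul_add, Complex.exp_add, mul_comm Complex.I (-(Real.pi / 2) : ℂ),
      neg_mul, Complex.exp_neg, Complex.exp_pi_div_two_mul_I, Complex.inv_I, mul_comm]
  · intro β hβ
    have hlt : β < y := hβ.2.trans_lt (max_lt h₂ (by linarith [Real.pi_pos]))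
    have hgt : y - Real.pi < β := (lt_min h₁ (by linarith [Real.pi_pos])).trans_le hβ.1
    exact ⟨hlt.ne, abs_lt.2 ⟨by linarith, by linarith [Real.pi_pos]⟩⟩

end Jump

section JumpPow

variable {β₁ β₂ ρ y : ℝ} {ψ : ℂ → ℂ}

lemma polar_notMem_closedSector_left (hρ : 0 < ρ) (h₁ : β₁ < y) (h₂ : y < β₂)
    (hβ : β₂ - β₁ < Real.pi) : polar ρ y ∉ closedSector β₁ β₁ :=
  polar_notMem_closedSector hρ fun x hx₁ hx₂ =>
    ⟨by linarith, abs_lt.2 ⟨by linarith [Real.pi_pos], by linarith⟩⟩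

lemma polar_notMem_closedSector_right (hρ : 0 < ρ) (h₁ : β₁ < y) (h₂ : y < β₂)
    (hβ : β₂ - β₁ < Real.pi) : polar ρ y ∉ closedSector β₂ β₂ :=
  polar_notMem_closedSector hρ fun x hx₁ hx₂ =>
    ⟨by linarith, abs_lt.2 ⟨by linarith, by linarith [Real.pi_pos]⟩⟩

/-- Subtracting `ψ p * 2 p / (s + p)` from `ψ` removes the pole without spoiling the decay, and
leaves a multiple of the kernel whose integrals are explicit. -/
lemma jump_inv_sub_mul (hρ : 0 < ρ) (h₁ : β₁ < y) (h₂ : y < β₂) (hβ : β₂ - β₁ < Real.pi)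
    (hψ : DecaysOn 1 ψ (closedSector β₁ β₂)) :
    rayIntegral (fun s => (s - polar ρ y)⁻¹ * ψ s) β₂ -
      rayIntegral (fun s => (s - polar ρ y)⁻¹ * ψ s) β₁ =
      -(2 * Real.pi * Complex.I) * ψ (polar ρ y) := by
  set p := polar ρ y
  have hβ' : β₁ ≤ β₂ := (h₁.trans h₂).le
  have hneg : -p ∉ closedSector β₁ β₂ :=
    neg_polar_notMem_closedSector hρ (by linarith) (by linarith)
  set χ : ℂ → ℂ := fun s => ψ s - ψ p * (2 * p) * (s - -p)⁻¹ with hχ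
  have hχp : χ p = 0 := by
    have : p ≠ 0 := polar_ne_zero hρ y
    simp only [hχ, sub_neg_eq_add, ← two_mul]
    field_simp
    ring
  have hdecay : DecaysOn 2 (dslope χ p) (closedSector β₁ β₂) := by
    refine DecaysOn.dslope (isClosed_closedSector _ _) (closedSector_mem_nhds hρ h₁ h₂) ?_
    simpa only [hχp, sub_zero] using
      hψ.sub ((DecaysOn.inv_sub (isClosed_closedSector _ _) hneg).const_mul (ψ p * (2 * p)))
  have hsplit : ∀ x ∈ Icc β₁ β₂, p ∉ closedSector x x →
      rayIntegral (fun s => (s - p)⁻¹ * ψ s) x =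
        rayIntegral (dslope χ p) β₁ + ψ p * rayIntegral (cauchyKernel p) x := by
    intro x hx hpx
    have hsub := closedSector_subset hx.1 hx.2
    rw [← rayIntegral_eq_of_decaysOn hx ⟨le_rfl, hβ'⟩ hdecay, ← rayIntegral_const_mul,
      ← rayIntegral_add (hdecay.mono_set hsub).integrableOn (((decaysOn_cauchyKernel
        (isClosed_closedSector _ _) hpx fun h => hneg (hsub h)).const_mul (ψ p)).integrableOn)]
    refine rayIntegral_congr fun r hr => ?_
    have hmem := polar_mem_closedSector hr.le (le_refl x) le_rfl
    have hne : polar r x - p ≠ 0 := sub_ne_zero.2 fun h => hpx (h ▸ hmem)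
    rw [dslope_of_ne _ (sub_ne_zero.1 hne), slope_def_field, hχp, sub_zero, cauchyKernel]
    simp only [hχ]
    field_simp
    ring
  rw [hsplit β₂ ⟨hβ', le_rfl⟩ (polar_notMem_closedSector_right hρ h₁ h₂ hβ),
    hsplit β₁ ⟨le_rfl, hβ'⟩ (polar_notMem_closedSector_left hρ h₁ h₂ hβ),
    rayIntegral_cauchyKernel_of_gt hρ h₂ (by linarith),
    rayIntegral_cauchyKernel_of_lt hρ (by linarith) h₁]
  ring

lemma rayIntegral_inv_sub_pow_mul_succ {p : ℂ} {x : ℝ} (hp : p ∉ closedSector x x)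
    (hψ : DecaysOn 1 (dslope ψ p) (closedSector x x)) (n : ℕ) :
    rayIntegral (fun s => ((s - p) ^ (n + 2))⁻¹ * ψ s) x =
      ψ p * ((n + 1) * (-p) ^ (n + 1))⁻¹ +
        rayIntegral (fun s => ((s - p) ^ (n + 1))⁻¹ * dslope ψ p s) x := by
  have hinv := fun m => DecaysOn.inv_sub_pow (isClosed_closedSector x x) hp m
  rw [← rayIntegral_inv_sub_pow hp, ← rayIntegral_const_mul, ← rayIntegral_add]
  · refine rayIntegral_congr fun r hr => ?_
    have hmem := polar_mem_closedSector hr.le (le_refl x) le_rfl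
    have hne : polar r x - p ≠ 0 := sub_ne_zero.2 fun h => hp (h ▸ hmem)
    rw [dslope_of_ne _ (sub_ne_zero.1 hne), slope_def_field]
    field_simp
    ring
  · exact (((hinv (n + 2)).mono (Nat.le_add_left 2 n)).const_mul (ψ p)).integrableOn
  · exact (((hinv (n + 1)).mul hψ).mono (by lia : 2 ≤ n + 1 + 1)).integrableOn

lemma jump_inv_sub_pow_mul (hρ : 0 < ρ) (h₁ : β₁ < y) (h₂ : y < β₂) (hβ : β₂ - β₁ < Real.pi)
    (hψ : DecaysOn 1 ψ (closedSector β₁ β₂)) (n : ℕ) :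
    rayIntegral (fun s => ((s - polar ρ y) ^ (n + 1))⁻¹ * ψ s) β₂ -
      rayIntegral (fun s => ((s - polar ρ y) ^ (n + 1))⁻¹ * ψ s) β₁ =
      -(2 * Real.pi * Complex.I) * (iteratedDeriv n ψ (polar ρ y) / n.factorial) := by
  induction n generalizing ψ with
  | zero => simpa using jump_inv_sub_mul hρ h₁ h₂ hβ hψ
  | succ n ih =>
    have hβ' : β₁ ≤ β₂ := (h₁.trans h₂).le
    have hmem := closedSector_mem_nhds hρ h₁ h₂
    have hd : DecaysOn 1 (dslope ψ (polar ρ y)) (closedSector β₁ β₂) :=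
      DecaysOn.dslope (isClosed_closedSector _ _) hmem
        ((hψ.mono zero_le_one).sub (DecaysOn.const (ψ (polar ρ y)) _))
    have han : AnalyticAt ℂ ψ (polar ρ y) :=
      DifferentiableOn.analyticAt (fun s hs => (hψ.1 s hs).differentiableWithinAt) hmem
    rw [rayIntegral_inv_sub_pow_mul_succ (polar_notMem_closedSector_right hρ h₁ h₂ hβ)
        (hd.mono_set (closedSector_subset hβ' le_rfl)),
      rayIntegral_inv_sub_pow_mul_succ (polar_notMem_closedSector_left hρ h₁ h₂ hβ)
        (hd.mono_set (closedSector_subset le_rfl hβ')), add_sub_add_left_eq_sub, ih hd,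
      iteratedDeriv_dslope_div_factorial han]

end JumpPow

section JumpPrincipalPart

variable {b : ℕ → ℂ} {ψ : ℂ → ℂ} {p : ℂ} {x : ℝ}

lemma RapidDecay.decaysOn_principalPart (hb : RapidDecay b) {S : Set ℂ} (hS : IsClosed S)
    (hp : p ∉ S) : DecaysOn 0 (principalPart b p) S := by
  obtain ⟨c, hc, hcS⟩ := exists_forall_le_norm_sub hS hp
  obtain ⟨B, -, hB⟩ := hb.exists_bound hc
  exact ⟨fun s hs => hb.differentiableAt fun h => hp (h ▸ hs), B,
    fun s hs => by rw [pow_zero, mul_one]; exact hB p s (hcS s hs)⟩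

lemma norm_exp_I_mul (x : ℝ) : ‖Complex.exp (Complex.I * x)‖ = 1 := by
  rw [mul_comm, Complex.norm_exp_ofReal_mul_I]

lemma RapidDecay.hasSum_rayIntegral (hb : RapidDecay b) (hp : p ∉ closedSector x x)
    (hψ : DecaysOn 2 ψ (closedSector x x)) :
    HasSum (fun n => b n * rayIntegral (fun s => ((s - p) ^ (n + 1))⁻¹ * ψ s) x)
      (rayIntegral (fun s => principalPart b p s * ψ s) x) := by
  obtain ⟨c, hc, hcS⟩ := exists_forall_le_norm_sub (isClosed_closedSector x x) hp
  have hint : ∀ n : ℕ,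
      IntegrableOn (fun r => ((polar r x - p) ^ (n + 1))⁻¹ * ψ (polar r x)) (Ioi 0) := fun n =>
    (((DecaysOn.inv_sub_pow (isClosed_closedSector x x) hp (n + 1)).mul hψ).mono
      (Nat.le_add_left 2 (n + 1))).integrableOn
  have key := hasSum_integral_of_summable_integral_norm (μ := volume.restrict (Ioi (0 : ℝ)))
    (F := fun n r => b n * (((polar r x - p) ^ (n + 1))⁻¹ * ψ (polar r x) *
      Complex.exp (Complex.I * x))) (fun n => ((hint n).mul_const _).const_mul _) ?_
  · convert! key using 1
    · funext n
      rw [integral_const_mul, rayIntegral]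
    · rw [rayIntegral]
      congr 1
      funext r
      rw [principalPart, mul_assoc, ← tsum_mul_right]
      simp only [div_eq_mul_inv, mul_assoc]
  · refine Summable.of_nonneg_of_le (fun n => integral_nonneg fun r => norm_nonneg _) (fun n => ?_)
      (((hb _ (inv_nonneg.2 hc.le)).mul_right c⁻¹).mul_right
        (∫ r in Ioi (0 : ℝ), ‖ψ (polar r x)‖))
    rw [← integral_const_mul]
    refine integral_mono_of_nonneg (.of_forall fun r => norm_nonneg _)
      (hψ.integrableOn.norm.const_mul _)
      ((ae_restrict_iff' measurableSet_Ioi).2 (.of_forall fun r hr => ?_))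
    have hle := norm_div_pow_le (b := b n) hc
      (hcS _ (polar_mem_closedSector (mem_Ioi.1 hr).le le_rfl le_rfl)) n
    simp only [norm_mul, norm_exp_I_mul, mul_one]
    rw [← mul_assoc, ← norm_mul, ← div_eq_mul_inv]
    gcongr

lemma RapidDecay.hasSum_jump (hb : RapidDecay b) {β₁ β₂ ρ y : ℝ} (hρ : 0 < ρ) (h₁ : β₁ < y)
    (h₂ : y < β₂) (hβ : β₂ - β₁ < Real.pi) (hψ : DecaysOn 2 ψ (closedSector β₁ β₂)) :
    HasSum (fun n => b n * (-(2 * Real.pi * Complex.I) *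
        (iteratedDeriv n ψ (polar ρ y) / n.factorial)))
      (rayIntegral (fun s => principalPart b (polar ρ y) s * ψ s) β₂ -
        rayIntegral (fun s => principalPart b (polar ρ y) s * ψ s) β₁) := by
  have hβ' : β₁ ≤ β₂ := (h₁.trans h₂).le
  have h := (hb.hasSum_rayIntegral (polar_notMem_closedSector_right hρ h₁ h₂ hβ)
    (hψ.mono_set (closedSector_subset hβ' le_rfl))).sub
    (hb.hasSum_rayIntegral (polar_notMem_closedSector_left hρ h₁ h₂ hβ)
      (hψ.mono_set (closedSector_subset le_rfl hβ')))
  simpa only [← mul_sub, jump_inv_sub_pow_mul hρ h₁ h₂ hβ (hψ.mono one_le_two)] using h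

end JumpPrincipalPart

/-! ### Analytic continuation along a half-line -/

section Continuation

variable {g h : ℂ → ℂ} {ρ x : ℝ}

lemma isPreconnected_ball_diff_center (q : ℂ) (c : ℝ) :
    IsPreconnected (Metric.ball q c \ {q}) := by
  have himage : (fun v : ℝ × ℝ => q + polar v.1 v.2) '' (Ioo 0 c ×ˢ univ) =
      Metric.ball q c \ {q} := by
    ext s
    constructor
    · rintro ⟨⟨r, y⟩, ⟨⟨hr, hrc⟩, -⟩, rfl⟩
      refine ⟨by simpa [norm_polar hr.le] using hrc, fun hs => polar_ne_zero hr y ?_⟩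
      simpa using hs
    · rintro ⟨hs, hsq⟩
      have : 0 < ‖s - q‖ := norm_pos_iff.2 (sub_ne_zero.2 hsq)
      exact ⟨(‖s - q‖, Complex.arg (s - q)), ⟨⟨this, mem_ball_iff_norm.1 hs⟩, mem_univ _⟩, by
        simp [polar_norm_arg]⟩
  rw [← himage]
  exact ((isPreconnected_Ioo).prod isPreconnected_univ).image _
    (continuous_const.add continuous_polar).continuousOn

lemma eqOn_polar_of_eventuallyEq {J : Set ℝ} (hJ : IsPreconnected J) (h₀ : 0 ∈ J)
    (hg : ∀ r ∈ J, AnalyticAt ℂ g (polar r x)) (hh : ∀ r ∈ J, AnalyticAt ℂ h (polar r x))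
    (hgh : g =ᶠ[𝓝 0] h) : EqOn g h ((polar · x) '' J) := by
  refine AnalyticOnNhd.eqOn_of_preconnected_of_eventuallyEq (z₀ := 0) (forall_mem_image.2 hg)
    (forall_mem_image.2 hh) (hJ.image _ (continuous_polar_left x).continuousOn)
    ⟨0, h₀, polar_zero x⟩ hgh

lemma eventually_nhdsNE_eq_of_eventuallyEq (hρ : 0 < ρ)
    (hg : ∀ r ∈ Icc 0 ρ, AnalyticAt ℂ g (polar r x)) (hh : ∀ s ≠ polar ρ x, AnalyticAt ℂ h s)
    (hgh : g =ᶠ[𝓝 0] h) : ∀ᶠ s in 𝓝[≠] polar ρ x, g s = h s := by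
  set q := polar ρ x
  obtain ⟨c, hc, hball⟩ := Metric.eventually_nhds_iff_ball.1
    (hg ρ (right_mem_Icc.2 hρ.le)).eventually_analyticAt
  set W := (polar · x) '' Ico 0 ρ ∪ Metric.ball q c \ {q}
  have hnorm : ∀ r ∈ Ico 0 ρ, polar r x ≠ q := by
    rintro r ⟨h₀, h₁⟩ he
    have := congrArg norm he
    rw [norm_polar h₀, norm_polar hρ.le] at this
    exact h₁.ne this
  have hW : IsPreconnected W := by
    have hnear : ∀ᶠ r in 𝓝[<] ρ, polar r x ∈ Metric.ball q c :=
      ((continuous_polar_left x).tendsto ρ).mono_left nhdsWithin_le_nhds (Metric.ball_mem_nhds q hc)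
    obtain ⟨r, hmem, hr₀⟩ := (hnear.and (Ico_mem_nhdsLT hρ)).exists
    exact .union _ ⟨r, hr₀, rfl⟩ ⟨hmem, hnorm r hr₀⟩
      (isPreconnected_Ico.image _ (continuous_polar_left x).continuousOn)
      (isPreconnected_ball_diff_center q c)
  have hgW : AnalyticOnNhd ℂ g W := by
    rintro s (⟨r, hr, rfl⟩ | hs)
    exacts [hg r (Ico_subset_Icc_self hr), hball s hs.1]
  have hhW : AnalyticOnNhd ℂ h W := by
    rintro s (⟨r, hr, rfl⟩ | hs)
    exacts [hh _ (hnorm r hr), hh _ hs.2]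
  have hEq := hgW.eqOn_of_preconnected_of_eventuallyEq hhW hW
    (Or.inl ⟨0, left_mem_Ico.2 hρ, polar_zero x⟩) hgh
  filter_upwards [sdiff_mem_nhdsWithin_compl (Metric.ball_mem_nhds q hc) {q}] with s hs
  exact hEq (Or.inr hs)

end Continuation

/-! ### The even part of a function as a function of the square of the variable -/

section EvenPart

variable {f : ℂ → ℂ} {p s : ℂ}

/-- The function `s ↦ (f (√s) + f (-√s)) / 2`, which does not depend on the choice of the root.
It is the continued deceleration of the formal heat solution with initial value `f`. -/
def evenPart (f : ℂ → ℂ) (s : ℂ) : ℂ := (f (s ^ (1 / 2 : ℂ)) + f (-s ^ (1 / 2 : ℂ))) / 2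

lemma cpow_one_half_sq (s : ℂ) : (s ^ (1 / 2 : ℂ)) ^ 2 = s := by
  rw [one_div, show (2 : ℂ) = ((2 : ℕ) : ℂ) by norm_num, Complex.cpow_nat_inv_pow s two_ne_zero]

lemma evenPart_sq (f : ℂ → ℂ) (w : ℂ) : evenPart f (w ^ 2) = (f w + f (-w)) / 2 := by
  rcases sq_eq_sq_iff_eq_or_eq_neg.1 (cpow_one_half_sq (w ^ 2)) with h | h
  · rw [evenPart, h]
  · rw [evenPart, h, neg_neg, add_comm]

lemma hasSum_evenPart (hf : DifferentiableOn ℂ f {p}ᶜ) (hs : ‖s‖ < ‖p‖ ^ 2) :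
    HasSum (fun n : ℕ => iteratedDeriv (2 * n) f 0 / (2 * n).factorial * s ^ n)
      (evenPart f s) := by
  obtain ⟨w, rfl⟩ : ∃ w, w ^ 2 = s := ⟨_, cpow_one_half_sq s⟩
  rw [norm_pow] at hs
  have hw : ‖w‖ < ‖p‖ := lt_of_pow_lt_pow_left₀ 2 (norm_nonneg p) hs
  have hball : DifferentiableOn ℂ f (Metric.ball 0 ‖p‖) := hf.mono fun v hv => by
    rintro rfl
    simp at hv
  have hpos := hasSum_taylor hball hw
  have hneg := hasSum_taylor hball (w := -w) (by rwa [norm_neg])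
  rw [zero_add] at hpos hneg
  have hsum := (hpos.add hneg).div_const 2
  rw [evenPart_sq]
  refine (Function.Injective.hasSum_iff (mul_right_injective₀ (two_ne_zero (α := ℕ)))
    fun m hm => ?_).2 hsum |>.congr_fun fun n => ?_
  · have : Odd m := Nat.not_even_iff_odd.1 fun he =>
      hm (he.two_dvd.imp fun _ h => h.symm)
    rw [this.neg_pow]
    ring
  · rw [Function.comp_apply, (even_two_mul n).neg_pow, pow_mul]
    ring

lemma differentiableAt_evenPart (hf : DifferentiableOn ℂ f {p}ᶜ) (hp : p ≠ 0) (hs : s ≠ p ^ 2) :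
    DifferentiableAt ℂ (evenPart f) s := by
  obtain ⟨w, rfl⟩ : ∃ w, w ^ 2 = s := ⟨_, cpow_one_half_sq s⟩
  rcases eq_or_ne w 0 with rfl | hw
  · refine (hasFPowerSeriesAt_ofScalars (x := 0 ^ 2)
      (c := fun n => iteratedDeriv (2 * n) f 0 / (2 * n).factorial) ?_).analyticAt.differentiableAt
    filter_upwards [Metric.ball_mem_nhds (0 : ℂ) (show 0 < ‖p‖ ^ 2 by positivity)] with v hv
    simpa using hasSum_evenPart hf (by simpa using hv)
  -- the branch of the square root near `w ^ 2` with the value `w`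
  set root : ℂ → ℂ := fun v => w * (v / w ^ 2) ^ (1 / 2 : ℂ)
  have hroot : DifferentiableAt ℂ root (w ^ 2) := by
    have : w ^ 2 / w ^ 2 ∈ Complex.slitPlane := by
      rw [div_self (pow_ne_zero 2 hw)]; exact Complex.one_mem_slitPlane
    fun_prop (disch := assumption)
  have hroot_sq : ∀ v, root v ^ 2 = v := fun v => by
    rw [mul_pow, cpow_one_half_sq, mul_div_cancel₀ _ (pow_ne_zero 2 hw)]
  have hf' : ∀ v, v ^ 2 = w ^ 2 → DifferentiableAt ℂ f v := fun v hv =>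
    hf.differentiableAt (isOpen_compl_singleton.mem_nhds fun h => hs (by rw [← hv, h]))
  have heq : evenPart f = fun v => (f (root v) + f (-root v)) / 2 := by
    funext v
    rw [← evenPart_sq, hroot_sq]
  have hpos : DifferentiableAt ℂ (fun v => f (root v)) (w ^ 2) :=
    (hf' _ (hroot_sq _)).comp _ hroot
  have hneg : DifferentiableAt ℂ (fun v => f (-root v)) (w ^ 2) :=
    DifferentiableAt.comp (f := fun v => -root v) (w ^ 2) (hf' _ (by rw [neg_sq, hroot_sq]))
      hroot.fun_neg
  rw [heq]
  exact (hpos.add hneg).div_const 2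

end EvenPart

/-! ### Gaussian growth -/

/-- `f` is complex differentiable at the points of `S` and `O(exp (B |s|²))` there: the explicit
exponent `B` limits the times `t` for which a heat kernel beats the growth of `f`. -/
structure GrowsOn (B : ℝ) (f : ℂ → ℂ) (S : Set ℂ) : Prop where
  differentiableAt : ∀ s ∈ S, DifferentiableAt ℂ f s
  bound : ∃ A > 0, ∀ s ∈ S, ‖f s‖ ≤ A * Real.exp (B * ‖s‖ ^ 2)

lemma DecaysOn.growsOn {f : ℂ → ℂ} {S : Set ℂ} {B : ℝ} (hf : DecaysOn 0 f S) (hB : 0 ≤ B) :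
    GrowsOn B f S := by
  obtain ⟨C, hC⟩ := hf.bound
  refine ⟨hf.1, max C 1, lt_max_of_lt_right one_pos, fun s hs => ?_⟩
  calc ‖f s‖ ≤ max C 1 * 1 := by simpa using Or.inl (hC s hs)
    _ ≤ max C 1 * Real.exp (B * ‖s‖ ^ 2) := by
      gcongr
      exact Real.one_le_exp (by positivity)

namespace GrowsOn

variable {f g : ℂ → ℂ} {S T : Set ℂ} {B : ℝ}

lemma mono_set (hf : GrowsOn B f S) (h : T ⊆ S) : GrowsOn B f T :=
  ⟨fun s hs => hf.1 s (h hs), hf.2.imp fun _ hA => ⟨hA.1, fun s hs => hA.2 s (h hs)⟩⟩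

lemma add (hf : GrowsOn B f S) (hg : GrowsOn B g S) : GrowsOn B (fun s => f s + g s) S := by
  obtain ⟨A, hA, hfA⟩ := hf.2
  obtain ⟨A', hA', hgA⟩ := hg.2
  refine ⟨fun s hs => (hf.1 s hs).add (hg.1 s hs), A + A', by positivity, fun s hs => ?_⟩
  rw [add_mul]
  exact norm_add_le_of_le (hfA s hs) (hgA s hs)

lemma comp_neg (hf : GrowsOn B f (Neg.neg ⁻¹' S)) : GrowsOn B (fun s => f (-s)) S := by
  obtain ⟨A, hA, hfA⟩ := hf.2
  have hmem : ∀ s ∈ S, -s ∈ Neg.neg ⁻¹' S := fun s hs => by simpa using hs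
  refine ⟨fun s hs => differentiableAt_comp_neg.2 (hf.1 _ (hmem s hs)), A, hA, fun s hs => ?_⟩
  simpa using hfA _ (hmem s hs)

lemma comp_const_add (hf : GrowsOn B f univ) (hB : 0 ≤ B) (z : ℂ) :
    GrowsOn (2 * B) (fun s => f (z + s)) univ := by
  obtain ⟨A, hA, hfA⟩ := hf.2
  refine ⟨fun s _ => (hf.1 (z + s) (mem_univ _)).comp s (differentiableAt_id.const_add z),
    A * Real.exp (2 * B * ‖z‖ ^ 2), by positivity, fun s _ => ?_⟩
  have hsq : ‖z + s‖ ^ 2 ≤ 2 * ‖z‖ ^ 2 + 2 * ‖s‖ ^ 2 := by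
    nlinarith [norm_add_le z s, norm_nonneg (z + s), sq_nonneg (‖z‖ - ‖s‖)]
  calc ‖f (z + s)‖ ≤ A * Real.exp (B * ‖z + s‖ ^ 2) := hfA _ (mem_univ _)
    _ ≤ A * Real.exp (B * (2 * ‖z‖ ^ 2 + 2 * ‖s‖ ^ 2)) := by gcongr
    _ = A * Real.exp (2 * B * ‖z‖ ^ 2) * Real.exp (2 * B * ‖s‖ ^ 2) := by
      rw [mul_assoc, ← Real.exp_add]
      ring_nf

lemma expGrowth {U : Set ℂ} (hd : DifferentiableOn ℂ f U) (hB : 0 < B)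
    (hf : ∀ β₁ β₂, ClosedSubsector U β₁ β₂ → GrowsOn B f (closedSector β₁ β₂)) :
    ExpGrowth 2 U f := by
  refine ⟨hd, fun β₁ β₂ hβ => ?_⟩
  obtain ⟨A, hA, hfA⟩ := (hf β₁ β₂ hβ).bound
  refine ⟨A, B, hA, hB, fun r x hr h₁ h₂ => ?_⟩
  simpa [norm_polar hr.le] using hfA _ (polar_mem_closedSector hr.le h₁ h₂)

end GrowsOn

lemma ExpGrowth.exists_growsOn_univ {f : ℂ → ℂ} (hf : ExpGrowth 2 univ f) :
    ∃ B > 0, GrowsOn B f univ := by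
  obtain ⟨hd, hgrowth⟩ := hf
  obtain ⟨C₁, C₂, hC₁, hC₂, hbound⟩ := hgrowth (-Real.pi) Real.pi fun _ _ _ _ _ => mem_univ _
  refine ⟨C₂, hC₂, fun s _ => (differentiableOn_univ.1 hd) s, max C₁ ‖f 0‖,
    lt_max_of_lt_left hC₁, fun s _ => ?_⟩
  rcases eq_or_ne s 0 with rfl | hs
  · simp
  have := hbound ‖s‖ (Complex.arg s) (norm_pos_iff.2 hs) (Complex.neg_pi_lt_arg s).le
    (Complex.arg_le_pi s)
  rw [polar_norm_arg, Real.rpow_two] at this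
  exact this.trans (by gcongr; exact le_max_left _ _)

lemma ClosedSubsector.notMem_closedSector {U : Set ℂ} {p : ℂ} {β₁ β₂ : ℝ}
    (h : ClosedSubsector U β₁ β₂) (hU : p ∉ U) (hp : p ≠ 0) : p ∉ closedSector β₁ β₂ := by
  rintro ⟨r, x, hr, h₁, h₂, rfl⟩
  rcases hr.eq_or_lt with rfl | hr
  · exact hp (polar_zero x)
  · exact hU (h r x hr h₁ h₂)

/-- `f` is the sum of the principal part at `p` with the coefficients `b` and of the entire
function `Q` of Gaussian growth with exponent `B`. -/
structure HasSingularPart (f : ℂ → ℂ) (b : ℕ → ℂ) (p : ℂ) (Q : ℂ → ℂ) (B : ℝ) : Prop where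
  exponent_pos : 0 < B
  rapidDecay : RapidDecay b
  growsOn_remainder : GrowsOn B Q univ
  eq_add : ∀ s ≠ p, f s = principalPart b p s + Q s

lemma RapidDecay.hasSingularPart {b : ℕ → ℂ} (hb : RapidDecay b) (p : ℂ) :
    HasSingularPart (principalPart b p) b p 0 1 :=
  ⟨one_pos, hb, (DecaysOn.const 0 univ).growsOn zero_le_one, fun s _ => by simp⟩

namespace HasSingularPart

variable {f : ℂ → ℂ} {b : ℕ → ℂ} {p : ℂ} {Q : ℂ → ℂ} {B : ℝ} {S U : Set ℂ}

lemma differentiableAt (h : HasSingularPart f b p Q B) {s : ℂ} (hs : s ≠ p) :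
    DifferentiableAt ℂ f s := by
  refine ((h.rapidDecay.differentiableAt hs).add
    (h.growsOn_remainder.1 s (mem_univ s))).congr_of_eventuallyEq ?_
  filter_upwards [isOpen_ne.mem_nhds hs] with v hv using h.eq_add v hv

lemma differentiableOn (h : HasSingularPart f b p Q B) (hU : p ∉ U) : DifferentiableOn ℂ f U :=
  fun _ hs => (h.differentiableAt fun he => hU (he ▸ hs)).differentiableWithinAt

lemma growsOn (h : HasSingularPart f b p Q B) (hS : IsClosed S) (hp : p ∉ S) : GrowsOn B f S := by
  obtain ⟨A, hA, hfA⟩ := (((h.rapidDecay.decaysOn_principalPart hS hp).growsOn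
    h.exponent_pos.le).add (h.growsOn_remainder.mono_set (subset_univ S))).bound
  have hne : ∀ s ∈ S, s ≠ p := fun s hs he => hp (he ▸ hs)
  exact ⟨fun s hs => h.differentiableAt (hne s hs), A, hA, fun s hs => by
    rw [h.eq_add s (hne s hs)]; exact hfA s hs⟩

lemma expGrowth (h : HasSingularPart f b p Q B) (hp : p ≠ 0) (hU : p ∉ U) : ExpGrowth 2 U f :=
  GrowsOn.expGrowth (h.differentiableOn hU) h.exponent_pos fun _ _ hβ =>
    h.growsOn (isClosed_closedSector _ _) (hβ.notMem_closedSector hU hp)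

lemma growsOn_comp_neg (h : HasSingularPart f b p Q B) (hS : IsClosed S) (hp : -p ∉ S) :
    GrowsOn B (fun s => f (-s)) S :=
  (h.growsOn (hS.preimage continuous_neg) hp).comp_neg

lemma expGrowth_comp_neg (h : HasSingularPart f b p Q B) (hp : p ≠ 0) (hU : -p ∉ U) :
    ExpGrowth 2 U fun s => f (-s) := by
  refine GrowsOn.expGrowth (fun s hs => ?_) h.exponent_pos fun β₁ β₂ hβ =>
    h.growsOn_comp_neg (isClosed_closedSector _ _)
      (hβ.notMem_closedSector hU (neg_ne_zero.2 hp))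
  exact (differentiableAt_comp_neg.2 <| h.differentiableAt fun he =>
    hU (by rwa [← he, neg_neg])).differentiableWithinAt

lemma expGrowth_remainder (h : HasSingularPart f b p Q B) : ExpGrowth 2 U Q :=
  GrowsOn.expGrowth (fun s _ => (h.growsOn_remainder.1 s (mem_univ s)).differentiableWithinAt)
    h.exponent_pos fun _ _ _ => h.growsOn_remainder.mono_set (subset_univ _)

lemma differentiableAt_evenPart (h : HasSingularPart f b p Q B) (hp : p ≠ 0) {s : ℂ}
    (hs : s ≠ p ^ 2) : DifferentiableAt ℂ (evenPart f) s :=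
  _root_.differentiableAt_evenPart (h.differentiableOn fun h => h rfl) hp hs

lemma analyticAt_evenPart (h : HasSingularPart f b p Q B) (hp : p ≠ 0) {s : ℂ}
    (hs : s ≠ p ^ 2) : AnalyticAt ℂ (evenPart f) s :=
  DifferentiableOn.analyticAt (s := {p ^ 2}ᶜ)
    (fun _ hv => (h.differentiableAt_evenPart hp hv).differentiableWithinAt)
    (isOpen_compl_singleton.mem_nhds hs)

lemma exists_norm_evenPart_le (h : HasSingularPart f b p Q B) (hS : IsClosed S)
    (hp : p ^ 2 ∉ S) : ∃ A > 0, ∀ s ∈ S, ‖evenPart f s‖ ≤ A * Real.exp (B * ‖s‖) := by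
  obtain ⟨A, hA, hfA⟩ := (h.growsOn (hS.preimage (continuous_pow 2)) hp).bound
  refine ⟨A, hA, fun s hs => ?_⟩
  obtain ⟨w, rfl⟩ : ∃ w, w ^ 2 = s := ⟨_, cpow_one_half_sq s⟩
  have hpos := hfA w hs
  have hneg := hfA (-w) (by rwa [mem_preimage, neg_sq])
  rw [norm_neg] at hneg
  rw [evenPart_sq, norm_div, Complex.norm_ofNat, div_le_iff₀ two_pos, norm_pow]
  linarith [norm_add_le (f w) (f (-w))]

lemma expGrowth_evenPart (h : HasSingularPart f b p Q B) (hp : p ≠ 0) (hU : p ^ 2 ∉ U) :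
    ExpGrowth 1 U (evenPart f) := by
  refine ⟨fun s hs => (h.differentiableAt_evenPart hp fun he =>
    hU (he ▸ hs)).differentiableWithinAt, fun β₁ β₂ hβ => ?_⟩
  obtain ⟨A, hA, hfA⟩ := h.exists_norm_evenPart_le (isClosed_closedSector _ _)
    (hβ.notMem_closedSector hU (pow_ne_zero 2 hp))
  refine ⟨A, B, hA, h.exponent_pos, fun r x hr h₁ h₂ => ?_⟩
  simpa [norm_polar hr.le] using hfA _ (polar_mem_closedSector hr.le h₁ h₂)

end HasSingularPart

/-! ### Summability of the formal heat solution -/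

/-- The formal solution `∑ f⁽²ⁿ⁾(0) tⁿ / n!` at `z = 0` of the heat equation with initial value
`f`. -/
def heatSeries (f : ℂ → ℂ) : PowerSeries ℂ :=
  PowerSeries.mk fun n => iteratedDeriv (2 * n) f 0 / n.factorial

lemma coeff_formalDeceleration_heatSeries (f : ℂ → ℂ) (n : ℕ) :
    PowerSeries.coeff n (formalDeceleration 1 (1 / (1 + 1)) (heatSeries f)) =
      iteratedDeriv (2 * n) f 0 / (2 * n).factorial := by
  have h₁ : Real.Gamma (1 + (n : ℝ) / 1) = n.factorial := by
    rw [div_one, add_comm, Real.Gamma_nat_eq_factorial]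
  have h₂ : Real.Gamma (1 + (n : ℝ) / (1 / (1 + 1))) = (2 * n).factorial := by
    rw [← Real.Gamma_nat_eq_factorial]
    congr 1
    push_cast
    ring
  have : (n.factorial : ℂ) ≠ 0 := Nat.cast_ne_zero.2 n.factorial_ne_zero
  rw [formalDeceleration, heatSeries, PowerSeries.coeff_mk, PowerSeries.coeff_mk, h₁, h₂]
  push_cast
  field_simp

lemma polar_mem_hatSector {d α ρ r : ℝ} (hα : 0 < α) (hρ : 0 < ρ) (hr : 0 ≤ r) :
    polar r d ∈ hatSector d α ρ := by
  rcases hr.eq_or_lt with rfl | hr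
  · exact Or.inl (by simpa [polar_zero] using hρ)
  · exact Or.inr (polar_mem_sector hr (by linarith) (by linarith))

lemma exists_polar_notMem_hatSector {d y ρ : ℝ} (hρ : 0 < ρ) (hd : (d : Real.Angle) ≠ y) :
    ∃ ε > 0, polar ρ y ∉ hatSector d ε ρ := by
  have hne : polar 1 d ≠ polar 1 y := fun h => hd ((polar_eq_polar_iff one_pos one_pos).1 h).2
  have hnear : ∀ᶠ x in 𝓝 d, polar 1 x ≠ polar 1 y :=
    ContinuousAt.eventually_ne (by unfold polar; fun_prop) hne
  obtain ⟨ε, hε, hball⟩ := Metric.eventually_nhds_iff_ball.1 hnear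
  refine ⟨ε, hε, ?_⟩
  rintro (h | ⟨r, x, hr, h₁, h₂, h⟩)
  · simp [norm_polar hρ.le] at h
  · refine hball x ?_ ((polar_eq_polar_iff one_pos one_pos).2
      ⟨rfl, ((polar_eq_polar_iff hρ hr).1 h).2.symm⟩)
    rw [Metric.mem_ball, Real.dist_eq, abs_lt]
    constructor <;> linarith

namespace HasSingularPart

variable {f Q g : ℂ → ℂ} {b : ℕ → ℂ} {p : ℂ} {B σ y d ρ : ℝ}

lemma hasSum_formalDeceleration (h : HasSingularPart f b p Q B) {s : ℂ} (hs : ‖s‖ < ‖p‖ ^ 2) :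
    HasSum (fun n : ℕ => PowerSeries.coeff n
      (formalDeceleration 1 (1 / (1 + 1)) (heatSeries f)) * s ^ n) (evenPart f s) := by
  simpa only [coeff_formalDeceleration_heatSeries] using
    hasSum_evenPart (h.differentiableOn fun hp => hp rfl) hs

lemma eventuallyEq_evenPart (h : HasSingularPart f b p Q B) (hp : p ≠ 0) (hρ : 0 < ρ)
    (hg : ∀ s ∈ Metric.ball (0 : ℂ) ρ, HasSum (fun n : ℕ =>
      PowerSeries.coeff n (formalDeceleration 1 (1 / (1 + 1)) (heatSeries f)) * s ^ n) (g s)) :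
    g =ᶠ[𝓝 0] evenPart f := by
  filter_upwards [Metric.ball_mem_nhds (0 : ℂ) hρ,
    Metric.ball_mem_nhds (0 : ℂ) (show 0 < ‖p‖ ^ 2 by positivity)] with s hs hs'
  exact (hg s hs).unique (h.hasSum_formalDeceleration (by simpa using hs'))

lemma isContinuedDeceleration (h : HasSingularPart f b (polar σ y) Q B) (hσ : 0 < σ)
    (hd : (d : Real.Angle) ≠ (2 * y : ℝ)) :
    IsContinuedDeceleration 1 d (heatSeries f) (evenPart f) := by
  have hσ₂ : 0 < σ ^ 2 := by positivity
  obtain ⟨ε, hε, hmem⟩ := exists_polar_notMem_hatSector hσ₂ hd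
  refine ⟨ε, σ ^ 2, hε, hσ₂, h.expGrowth_evenPart (polar_ne_zero hσ y) (by rwa [polar_sq]),
    fun s hs => h.hasSum_formalDeceleration ?_⟩
  rwa [norm_polar hσ.le, ← mem_ball_zero_iff]

lemma continuedDeceleration_polar (h : HasSingularPart f b (polar σ y) Q B) (hσ : 0 < σ)
    (hd : (d : Real.Angle) ≠ (2 * y : ℝ)) {r : ℝ} (hr : 0 ≤ r) :
    continuedDeceleration 1 d (heatSeries f) (polar r d) = evenPart f (polar r d) := by
  have hsum : KSummable 1 d (heatSeries f) := ⟨_, h.isContinuedDeceleration hσ hd⟩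
  rw [continuedDeceleration, dif_pos hsum]
  obtain ⟨ε, ρ, hε, hρ, ⟨hdiff, -⟩, hg⟩ := hsum.choose_spec
  have hp := polar_ne_zero hσ y
  refine eqOn_polar_of_eventuallyEq isPreconnected_Ici (self_mem_Ici (a := (0 : ℝ)))
    (fun r hr => hdiff.analyticAt ((isOpen_hatSector d ε ρ).mem_nhds
      (polar_mem_hatSector hε hρ hr)))
    (fun r hr => h.analyticAt_evenPart hp ?_) (h.eventuallyEq_evenPart hp hρ hg) ⟨r, hr, rfl⟩
  rw [polar_sq]
  rcases (mem_Ici.1 hr).eq_or_lt with rfl | hr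
  · rw [polar_zero]
    exact (polar_ne_zero (by positivity) _).symm
  · exact fun he => hd ((polar_eq_polar_iff hr (by positivity)).1 he).2

/-- Summability in the singular direction continues `evenPart f` to `p ^ 2`, so that the principal
part `2 evenPart f (w²) - f (-w) - Q w` of `f` is bounded near `p`. -/
lemma eq_zero_of_kSummable (h : HasSingularPart f b (polar σ y) Q B) (hσ : 0 < σ)
    (hsum : KSummable 1 (2 * y) (heatSeries f)) : b = 0 := by
  obtain ⟨g, ε, ρ, hε, hρ, ⟨hdiff, -⟩, hg⟩ := hsum
  set p := polar σ y
  have hp : p ≠ 0 := polar_ne_zero hσ y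
  have hp₂ : p ^ 2 = polar (σ ^ 2) (2 * y) := polar_sq σ y
  have hg_analytic : ∀ r, 0 ≤ r → AnalyticAt ℂ g (polar r (2 * y)) := fun r hr =>
    hdiff.analyticAt ((isOpen_hatSector _ _ _).mem_nhds (polar_mem_hatSector hε hρ hr))
  have heq : ∀ᶠ s in 𝓝[≠] (p ^ 2), g s = evenPart f s := by
    rw [hp₂]
    exact eventually_nhdsNE_eq_of_eventuallyEq (by positivity) (fun r hr => hg_analytic r hr.1)
      (fun s hs => h.analyticAt_evenPart hp (by rwa [hp₂])) (h.eventuallyEq_evenPart hp hρ hg)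
  have hpneg : p ≠ -p := self_ne_neg.2 hp
  have hcont : ContinuousAt (fun w => 2 * g (w ^ 2) - f (-w) - Q w) p := by
    have hgc : ContinuousAt (fun w => g (w ^ 2)) p :=
      ContinuousAt.comp' (hp₂ ▸ (hg_analytic _ (sq_nonneg σ)).continuousAt)
        (continuous_pow 2).continuousAt
    have hfc : ContinuousAt (fun w => f (-w)) p :=
      ContinuousAt.comp' (h.differentiableAt hpneg.symm).continuousAt continuous_neg.continuousAt
    exact ((continuousAt_const.mul hgc).sub hfc).sub
      (h.growsOn_remainder.1 p (mem_univ p)).continuousAt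
  have hbound : ∀ᶠ w in 𝓝 p, w ≠ p → ‖principalPart b p w‖ ≤
      ‖2 * g (p ^ 2) - f (-p) - Q p‖ + 1 := by
    filter_upwards [(continuous_pow 2).continuousAt.eventually (eventually_nhdsWithin_iff.1 heq),
      isOpen_ne.mem_nhds hpneg, hcont.norm.eventually (gt_mem_nhds (lt_add_one _))]
      with w hw hwneg hwlt hne
    have hge := hw fun he => (sq_eq_sq_iff_eq_or_eq_neg.1 he).elim hne hwneg
    rw [evenPart_sq, h.eq_add w hne] at hge
    have : principalPart b p w = 2 * g (w ^ 2) - f (-w) - Q w := by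
      rw [hge]
      ring
    exact this ▸ hwlt.le
  obtain ⟨c, hc, hball⟩ := Metric.eventually_nhds_iff_ball.1 hbound
  exact h.rapidDecay.eq_zero_of_bounded hc fun s hs hsc =>
    hball s (by rwa [mem_ball_iff_norm]) hs

lemma isStokesLine (h : HasSingularPart f b (polar σ y) Q B) (hσ : 0 < σ) (hb : b ≠ 0) :
    IsStokesLine 1 (2 * y) (heatSeries f) := by
  refine ⟨(finite_singleton ((2 * y : ℝ) : Real.Angle)).subset ?_,
    fun hsum => hb (h.eq_zero_of_kSummable hσ hsum)⟩
  rintro _ ⟨x, rfl, hx⟩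
  by_contra hne
  exact hx ⟨_, h.isContinuedDeceleration hσ hne⟩

end HasSingularPart

/-! ### The Ecalle kernel of index `2` -/

lemma factorial_mul_Gamma_half_sub (m : ℕ) :
    ((2 * m).factorial : ℝ) * Real.Gamma (1 / 2 - m) = (-4) ^ m * m.factorial * √Real.pi := by
  induction m with
  | zero => simp [Real.Gamma_one_half_eq, -one_div]
  | succ m ih =>
    have hne : (-1 / 2 - m : ℝ) ≠ 0 := by
      have : (0 : ℝ) ≤ m := m.cast_nonneg
      linarith
    have hGamma : Real.Gamma (1 / 2 - m) =
        (-1 / 2 - m) * Real.Gamma (1 / 2 - (m + 1 : ℕ)) := by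
      rw [show (1 / 2 - m : ℝ) = (-1 / 2 - m) + 1 by ring, Real.Gamma_add_one hne]
      congr 2
      push_cast
      ring
    have hfact : ((2 * (m + 1)).factorial : ℝ) =
        (2 * m + 2) * (2 * m + 1) * (2 * m).factorial := by
      rw [show 2 * (m + 1) = 2 * m + 1 + 1 by ring, Nat.factorial_succ, Nat.factorial_succ]
      push_cast
      ring
    rw [hGamma] at ih
    rw [hfact, Nat.factorial_succ, pow_succ]
    push_cast at ih ⊢
    linear_combination (-4) * (m + 1 : ℝ) * ih

lemma ecalleKernel_two (τ : ℂ) :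
    ecalleKernel 2 τ = Complex.exp (-τ ^ 2 / 4) / (√Real.pi : ℂ) := by
  have heven : HasSum (fun m : ℕ => (-τ) ^ (2 * m) / (((2 * m).factorial : ℂ) *
      (Real.Gamma (1 - (((2 * m : ℕ) : ℝ) + 1) / 2) : ℂ)))
      (Complex.exp (-τ ^ 2 / 4) / (√Real.pi : ℂ)) := by
    rw [Complex.exp_eq_exp_ℂ]
    refine ((NormedSpace.expSeries_div_hasSum_exp (-τ ^ 2 / 4)).div_const
      (√Real.pi : ℂ)).congr_fun fun m => ?_
    have hcoeff := congrArg (fun x : ℝ => (x : ℂ)) (factorial_mul_Gamma_half_sub m)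
    simp only [Complex.ofReal_mul, Complex.ofReal_natCast] at hcoeff
    rw [show (1 - (((2 * m : ℕ) : ℝ) + 1) / 2) = 1 / 2 - m by push_cast; ring, hcoeff,
      (even_two_mul m).neg_pow, pow_mul, show -τ ^ 2 / 4 = τ ^ 2 / (-4) by ring, div_pow]
    push_cast
    rw [div_div, div_div, mul_assoc]
  have hodd : HasSum (fun m : ℕ => (-τ) ^ (2 * m + 1) / (((2 * m + 1).factorial : ℂ) *
      (Real.Gamma (1 - (((2 * m + 1 : ℕ) : ℝ) + 1) / 2) : ℂ))) 0 := by
    refine hasSum_zero.congr_fun fun m => ?_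
    rw [show (1 - (((2 * m + 1 : ℕ) : ℝ) + 1) / 2) = -(m : ℝ) by push_cast; ring,
      Real.Gamma_neg_nat_eq_zero]
    simp
  have hsum := HasSum.even_add_odd (f := fun n : ℕ => (-τ) ^ n / ((n.factorial : ℂ) *
    (Real.Gamma (1 - ((n : ℝ) + 1) / 2) : ℂ))) heven hodd
  rw [add_zero] at hsum
  exact hsum.tsum_eq

/-! ### The heat kernel -/

lemma exp_neg_mul_sq_mul_one_add_sq_le {a : ℝ} (ha : 0 < a) (v : ℝ) :
    Real.exp (-(a * v ^ 2)) * (1 + v) ^ 2 ≤ 2 * max 1 a⁻¹ := by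
  rw [Real.exp_neg, inv_mul_le_iff₀ (Real.exp_pos _)]
  have hexp := Real.add_one_le_exp (a * v ^ 2)
  have hmax : 1 ≤ max 1 a⁻¹ := le_max_left _ _
  have hmul : 1 ≤ a * max 1 a⁻¹ := by
    rw [← mul_inv_cancel₀ ha.ne']
    gcongr
    exact le_max_right _ _
  nlinarith [sq_nonneg v, sq_nonneg (v - 1)]

lemma sqrt_four_mul_pi : √(4 * Real.pi) = 2 * √Real.pi := by
  rw [Real.sqrt_mul (by norm_num), show (4 : ℝ) = 2 ^ 2 by norm_num, Real.sqrt_sq (by norm_num)]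

lemma differentiable_heatKernel (τ ψ : ℝ) : Differentiable ℂ (heatKernel τ ψ) := by
  unfold heatKernel
  fun_prop

lemma norm_heatKernel {τ ψ v x : ℝ} (hτ : 0 < τ) :
    ‖heatKernel τ ψ (polar v x)‖ =
      (√(4 * Real.pi) * √τ)⁻¹ * Real.exp (-(Real.cos (2 * x - ψ) / (4 * τ) * v ^ 2)) := by
  have hτ' : (τ : ℂ) ≠ 0 := Complex.ofReal_ne_zero.2 hτ.ne'
  have hexponent : -polar v x ^ 2 / (4 * polar τ ψ) =
      -polar (v ^ 2 / (4 * τ)) (2 * x - ψ) := by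
    rw [div_eq_iff (mul_ne_zero (by norm_num) (polar_ne_zero hτ ψ)), neg_mul, mul_left_comm,
      polar_mul, sub_add_cancel, polar_sq]
    simp only [polar]
    push_cast
    field_simp
  rw [heatKernel, norm_mul, norm_div, norm_one, norm_mul, norm_polar (Real.sqrt_nonneg _),
    Complex.norm_real, Real.norm_of_nonneg (Real.sqrt_nonneg _), one_div, Complex.norm_exp,
    hexponent, Complex.neg_re, polar_re]
  congr 3
  ring

lemma GrowsOn.mul_heatKernel {g : ℂ → ℂ} {B κ τ ψ β₁ β₂ : ℝ}
    (hg : GrowsOn B g (closedSector β₁ β₂)) (hτ : 0 < τ)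
    (hκ : ∀ x, β₁ ≤ x → x ≤ β₂ → κ ≤ Real.cos (2 * x - ψ)) (hB : B < κ / (4 * τ)) :
    DecaysOn 2 (fun s => g s * heatKernel τ ψ s) (closedSector β₁ β₂) := by
  obtain ⟨A, hA, hgA⟩ := hg.bound
  set a := κ / (4 * τ) - B
  have ha : 0 < a := sub_pos.2 hB
  refine ⟨fun s hs => (hg.1 s hs).mul (differentiable_heatKernel τ ψ s),
    A * (√(4 * Real.pi) * √τ)⁻¹ * (2 * max 1 a⁻¹), ?_⟩
  rintro _ ⟨v, x, hv, h₁, h₂, rfl⟩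
  have hgv := hgA _ (polar_mem_closedSector hv h₁ h₂)
  rw [norm_polar hv] at hgv
  rw [norm_mul, norm_heatKernel hτ, norm_polar hv]
  calc ‖g (polar v x)‖ * ((√(4 * Real.pi) * √τ)⁻¹ *
        Real.exp (-(Real.cos (2 * x - ψ) / (4 * τ) * v ^ 2))) * (1 + v) ^ 2
      ≤ A * Real.exp (B * v ^ 2) * ((√(4 * Real.pi) * √τ)⁻¹ *
        Real.exp (-(κ / (4 * τ) * v ^ 2))) * (1 + v) ^ 2 := by
        gcongr
        exact hκ x h₁ h₂
    _ = A * (√(4 * Real.pi) * √τ)⁻¹ * (Real.exp (-(a * v ^ 2)) * (1 + v) ^ 2) := by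
      rw [show -(a * v ^ 2) = B * v ^ 2 + -(κ / (4 * τ) * v ^ 2) by ring, Real.exp_add]
      ring
    _ ≤ _ := mul_le_mul_of_nonneg_left (exp_neg_mul_sq_mul_one_add_sq_le ha v) (by positivity)

lemma decaysOn_heatKernel {τ ψ β₁ β₂ : ℝ} (hτ : 0 < τ)
    (hcos : ∀ x, β₁ ≤ x → x ≤ β₂ → 0 < Real.cos (2 * x - ψ)) :
    DecaysOn 2 (heatKernel τ ψ) (closedSector β₁ β₂) := by
  obtain ⟨κ, hκ, hle⟩ : ∃ κ > 0, ∀ x ∈ Icc β₁ β₂, κ ≤ Real.cos (2 * x - ψ) := by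
    rcases (Icc β₁ β₂).eq_empty_or_nonempty with he | hne
    · exact ⟨1, one_pos, by simp [he]⟩
    · obtain ⟨x₀, hx₀, hmin⟩ := isCompact_Icc.exists_isMinOn hne
        (f := fun x => Real.cos (2 * x - ψ)) (by fun_prop)
      exact ⟨_, hcos x₀ hx₀.1 hx₀.2, hmin⟩
  have h1 : GrowsOn 0 (fun _ => 1) (closedSector β₁ β₂) :=
    (DecaysOn.const 1 _).growsOn le_rfl
  simpa only [one_mul] using
    h1.mul_heatKernel hτ (fun x h₁ h₂ => hle x ⟨h₁, h₂⟩) (by positivity)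

/-! ### The `1`-sum as an integral against the heat kernel -/

section Sum

variable {f : ℂ → ℂ} {F : PowerSeries ℂ} {d τ ψ v : ℝ}

lemma polar_rpow_half (τ ψ : ℝ) :
    polar (τ ^ (1 / (1 + 1) : ℝ)) ((1 / (1 + 1) : ℝ) * ψ) = polar √τ (ψ / 2) := by
  rw [one_add_one_eq_two, ← Real.sqrt_eq_rpow, one_div_mul_eq_div]

/-- The integrand after the substitution `s = w ^ 2`, for which `ds^{1/2} = dw`. -/
lemma two_mul_accelIntegrand_sq {g : ℂ → ℂ} (hτ : 0 < τ) (hv : 0 < v)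
    (hg : g (polar (v ^ 2) d) = evenPart f (polar (v ^ 2) d)) :
    2 * v * accelIntegrand 1 (1 / (1 + 1)) d g τ ψ (v ^ 2) =
      polar √τ (ψ / 2) * ((f (polar v (d / 2)) + f (-polar v (d / 2))) *
        heatKernel τ ψ (polar v (d / 2)) * Complex.exp (Complex.I * (d / 2 : ℝ))) := by
  have hw : polar (v ^ 2) d = polar v (d / 2) ^ 2 := by
    rw [polar_sq, mul_div_cancel₀ _ two_ne_zero]
  have harg : polar ((v ^ 2 / τ) ^ (1 / (1 + 1) : ℝ)) ((1 / (1 + 1) : ℝ) * (d - ψ)) ^ 2 =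
      polar v (d / 2) ^ 2 / polar τ ψ := by
    rw [polar_rpow_half, polar_sq, Real.sq_sqrt (by positivity), eq_div_iff (polar_ne_zero hτ ψ),
      polar_mul, div_mul_cancel₀ _ hτ.ne', mul_div_cancel₀ _ two_ne_zero, sub_add_cancel, hw]
  have hpow : (v ^ 2) ^ (1 / (1 + 1) - 1 : ℝ) = v⁻¹ := by
    rw [← Real.rpow_natCast_mul hv.le, ← Real.rpow_neg_one]
    norm_num
  rw [accelIntegrand, hg, hw, evenPart_sq, hpow, show (1 / (1 / (1 + 1)) : ℝ) = 2 by norm_num,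
    ecalleKernel_two, harg, heatKernel, sqrt_four_mul_pi, neg_div, div_div, mul_comm (polar τ ψ),
    show (1 / (1 + 1) * d : ℝ) = d / 2 by ring, neg_div]
  have hpi : (√Real.pi : ℂ) ≠ 0 := by
    rw [Ne, Complex.ofReal_eq_zero]
    positivity
  have hP := polar_ne_zero (Real.sqrt_pos.2 hτ) (ψ / 2)
  have hv' : (v : ℂ) ≠ 0 := Complex.ofReal_ne_zero.2 hv.ne'
  have hmeasure : polar v⁻¹ (d / 2) = (v : ℂ)⁻¹ * Complex.exp (Complex.I * (d / 2 : ℝ)) := by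
    rw [polar, Complex.ofReal_inv]
  rw [hmeasure]
  push_cast
  field_simp
  ring

lemma kSum_eq_rayIntegral (hτ : 0 < τ)
    (hg : ∀ x : ℝ, 0 ≤ x → continuedDeceleration 1 d F (polar x d) = evenPart f (polar x d)) :
    kSum 1 d F τ ψ = rayIntegral (fun w => (f w + f (-w)) * heatKernel τ ψ w) (d / 2) := by
  have hP := polar_ne_zero (Real.sqrt_pos.2 hτ) (ψ / 2)
  rw [kSum, acceleration, polar_rpow_half, inv_mul_eq_iff_eq_mul₀ hP, rayIntegral,
    ← integral_const_mul, ← integral_comp_rpow_Ioi_of_pos two_pos]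
  refine setIntegral_congr_fun measurableSet_Ioi fun v hv => ?_
  simp only [← two_mul_accelIntegrand_sq hτ hv (hg _ (sq_nonneg v)), Real.rpow_two,
    Complex.real_smul]
  norm_num

lemma kSumConverges_of_integrableOn (hτ : 0 < τ)
    (hg : ∀ x : ℝ, 0 ≤ x → continuedDeceleration 1 d F (polar x d) = evenPart f (polar x d))
    (hi : IntegrableOn (fun r => (f (polar r (d / 2)) + f (-polar r (d / 2))) *
      heatKernel τ ψ (polar r (d / 2))) (Ioi 0)) : KSumConverges 1 d F τ ψ := by
  rw [KSumConverges, ← integrableOn_Ioi_comp_rpow_iff _ two_ne_zero]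
  refine IntegrableOn.congr_fun ((hi.mul_const (Complex.exp (Complex.I * (d / 2 : ℝ)))).const_mul
    (polar √τ (ψ / 2))) (fun v hv => ?_) measurableSet_Ioi
  simp only [← two_mul_accelIntegrand_sq hτ hv (hg _ (sq_nonneg v)), Real.rpow_two,
    Complex.real_smul]
  norm_num

end Sum

/-! ### Hyperfunctions -/

section Hyperfunction

variable {k θ α ρ σ y : ℝ} {b : ℕ → ℂ} {ψ : ℂ → ℂ}

lemma isDefiningFunction_of_eqOn {d : ℝ} {G : LaplaceHyperfunction k θ α ρ d} {g g' h : ℂ → ℂ}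
    (hg : IsDefiningFunction G g) (hg' : ExpGrowth k (slitSector θ α ρ d) g')
    (hh : ExpGrowth k (hatSector θ α ρ) h)
    (he : ∀ s ∈ slitSector θ α ρ d, g' s = g s + h s) : IsDefiningFunction G g' := by
  obtain ⟨hgm, rfl⟩ := hg
  refine ⟨hg', (Submodule.Quotient.eq _).2 ⟨h, hh, fun s hs => ?_⟩⟩
  change g' s - g s = h s
  rw [he s hs, add_sub_cancel_left]

lemma slitSector_subset (θ α ρ d : ℝ) : slitSector θ α ρ d ⊆ hatSector θ α ρ :=
  union_subset_union_right _ sdiff_subset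

lemma polar_notMem_ball (hσ : 0 < σ) (hρ : ρ ≤ σ) : polar σ y ∉ Metric.ball (0 : ℂ) ρ := by
  rwa [mem_ball_zero_iff, norm_polar hσ.le, not_lt]

lemma polar_notMem_slitSector (hσ : 0 < σ) (hρ : ρ ≤ σ) : polar σ y ∉ slitSector θ α ρ y := by
  rintro (h | ⟨-, h⟩)
  · exact polar_notMem_ball hσ hρ h
  · exact h ⟨σ, hσ, rfl⟩

lemma neg_polar_notMem_hatSector (hσ : 0 < σ) (hρ : ρ ≤ σ) (hα : α < Real.pi)
    (h₁ : θ - α / 2 < y) (h₂ : y < θ + α / 2) : -polar σ y ∉ hatSector θ α ρ := by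
  rintro (h | ⟨r, x, hr, hx₁, hx₂, he⟩)
  · rw [← polar_add_pi] at h
    exact polar_notMem_ball hσ hρ h
  · exact neg_polar_notMem_closedSector hσ (by linarith) (by linarith)
      (he ▸ polar_mem_closedSector hr.le hx₁.le hx₂.le)

lemma HasSingularPart.exists_hyperfunction {f Q : ℂ → ℂ} {B : ℝ}
    (h : HasSingularPart f b (polar σ y) Q B) (hσ : 0 < σ) (hρ : ρ ≤ σ) (hα : α < Real.pi)
    (h₁ : θ - α / 2 < y) (h₂ : y < θ + α / 2) :
    ∃ F : LaplaceHyperfunction 2 θ α ρ y, IsDefiningFunction F (fun s => f s + f (-s)) ∧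
      IsDefiningFunction F f ∧ IsDefiningFunction F (principalPart b (polar σ y)) := by
  have hp := polar_ne_zero hσ y
  have hslit : polar σ y ∉ slitSector θ α ρ y := polar_notMem_slitSector hσ hρ
  have hhat : -polar σ y ∉ hatSector θ α ρ := neg_polar_notMem_hatSector hσ hρ hα h₁ h₂
  have hne : ∀ s ∈ slitSector θ α ρ y, s ≠ polar σ y := fun s hs he => hslit (he ▸ hs)
  have hprincipal : ExpGrowth 2 (slitSector θ α ρ y) (principalPart b (polar σ y)) :=
    (h.rapidDecay.hasSingularPart _).expGrowth hp hslit
  have hF : IsDefiningFunction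
      (Submodule.Quotient.mk ⟨_, hprincipal⟩ : LaplaceHyperfunction 2 θ α ρ y)
      (principalPart b (polar σ y)) := ⟨hprincipal, rfl⟩
  have hneg : ExpGrowth 2 (hatSector θ α ρ) fun s => f (-s) := h.expGrowth_comp_neg hp hhat
  have hnegSlit : ExpGrowth 2 (slitSector θ α ρ y) fun s => f (-s) :=
    h.expGrowth_comp_neg hp fun hm => hhat (slitSector_subset _ _ _ _ hm)
  have hf := h.expGrowth hp hslit
  have hFf := isDefiningFunction_of_eqOn hF hf h.expGrowth_remainder
    fun s hs => h.eq_add s (hne s hs)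
  exact ⟨_, isDefiningFunction_of_eqOn hFf ((expGrowthSpace 2 _).add_mem hf hnegSlit) hneg
    fun _ _ => rfl, hFf, hF⟩

lemma RapidDecay.decaysOn_principalPart_mul (hb : RapidDecay b) {p : ℂ} {S : Set ℂ}
    (hS : IsClosed S) (hp : p ∉ S) {l : ℕ} (hψ : DecaysOn l ψ S) :
    DecaysOn l (fun s => principalPart b p s * ψ s) S := by
  simpa only [zero_add] using (hb.decaysOn_principalPart hS hp).mul hψ

lemma hasPairing_principalPart {G : LaplaceHyperfunction k θ α ρ y} (hb : RapidDecay b)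
    (hσ : 0 < σ) (hα : α < Real.pi) (h₁ : θ - α / 2 < y) (h₂ : y < θ + α / 2)
    (hG : IsDefiningFunction G (principalPart b (polar σ y)))
    (hψ : ∀ β₁ β₂ : ℝ, θ - α / 2 < β₁ → β₂ < θ + α / 2 → DecaysOn 2 ψ (closedSector β₁ β₂)) :
    ∃ v : ℂ, HasPairing G ψ v ∧ HasSum (fun n : ℕ => b n *
      (-(2 * Real.pi * Complex.I) * (iteratedDeriv n ψ (polar σ y) / n.factorial))) v := by
  have hjump : ∀ β₁ β₂ : ℝ, θ - α / 2 < β₁ → β₁ < y → y < β₂ → β₂ < θ + α / 2 → _ :=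
    fun β₁ β₂ hβ₁ hy₁ hy₂ hβ₂ => hb.hasSum_jump hσ hy₁ hy₂ (by linarith) (hψ β₁ β₂ hβ₁ hβ₂)
  have hintegrable : ∀ x : ℝ, θ - α / 2 < x → x < θ + α / 2 → polar σ y ∉ closedSector x x →
      IntegrableOn (fun r => principalPart b (polar σ y) (polar r x) * ψ (polar r x)) (Ioi 0) :=
    fun x hx₁ hx₂ hx => (hb.decaysOn_principalPart_mul (isClosed_closedSector x x) hx
      (hψ x x hx₁ hx₂)).integrableOn
  obtain ⟨β₁, hβ₁, hy₁⟩ := exists_between h₁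
  obtain ⟨β₂, hy₂, hβ₂⟩ := exists_between h₂
  have hv := hjump β₁ β₂ hβ₁ hy₁ hy₂ hβ₂
  refine ⟨_, ⟨_, hG, fun dm dp hm hmy hyp hp => ⟨hintegrable dm hm (by linarith) ?_,
    hintegrable dp (by linarith) hp ?_, (hjump dm dp hm hmy hyp hp).unique hv⟩⟩, hv⟩
  · exact polar_notMem_closedSector_left hσ hmy hyp (by linarith)
  · exact polar_notMem_closedSector_right hσ hmy hyp (by linarith)

lemma ExpDecay.decaysOn (h : ExpDecay 2 (hatSector θ α ρ) ψ) (hρ : 0 < ρ) {β₁ β₂ : ℝ}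
    (h₁ : θ - α / 2 < β₁) (h₂ : β₂ < θ + α / 2) : DecaysOn 2 ψ (closedSector β₁ β₂) := by
  have hsector : ClosedSubsector (hatSector θ α ρ) β₁ β₂ := fun r x hr hx₁ hx₂ =>
    Or.inr (polar_mem_sector hr (by linarith) (by linarith))
  obtain ⟨hd, hdecay⟩ := h
  obtain ⟨C₁, C₂, hC₁, hC₂, hbound⟩ := hdecay β₁ β₂ hsector
  have hpos : ∀ r x, 0 < r → β₁ ≤ x → x ≤ β₂ →
      ‖ψ (polar r x)‖ * (1 + r) ^ 2 ≤ C₁ * (2 * max 1 C₂⁻¹) := fun r x hr hx₁ hx₂ => by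
    calc ‖ψ (polar r x)‖ * (1 + r) ^ 2
        ≤ C₁ * Real.exp (-(C₂ * r ^ 2)) * (1 + r) ^ 2 := by
          gcongr
          simpa using hbound r x hr hx₁ hx₂
      _ ≤ C₁ * (2 * max 1 C₂⁻¹) := by
        rw [mul_assoc]
        exact mul_le_mul_of_nonneg_left (exp_neg_mul_sq_mul_one_add_sq_le hC₂ r) hC₁.le
  refine ⟨?_, max (C₁ * (2 * max 1 C₂⁻¹)) ‖ψ 0‖, ?_⟩ <;> rintro _ ⟨r, x, hr, hx₁, hx₂, rfl⟩ <;>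
    rcases hr.eq_or_lt with rfl | hr
  · rw [polar_zero]
    exact hd.differentiableAt ((isOpen_hatSector _ _ _).mem_nhds (Or.inl (by simpa using hρ)))
  · exact hd.differentiableAt ((isOpen_hatSector _ _ _).mem_nhds (hsector r x hr hx₁ hx₂))
  · simp [polar_zero]
  · rw [norm_polar hr.le]
    exact (hpos r x hr hx₁ hx₂).trans (le_max_left _ _)

end Hyperfunction

/-! ### Derivatives of the Dirac function -/

section Dirac

variable {k θ α ρ σ y : ℝ} {ψ : ℂ → ℂ}

lemma diracFunction_eq (m : ℕ) (c s : ℂ) :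
    diracFunction m c s =
      -((-1) ^ m * m.factorial / (2 * Real.pi * Complex.I)) / (s - c) ^ (m + 1) := by
  have h : (fun s : ℂ => -1 / (2 * (Real.pi : ℂ) * Complex.I * (s - c))) =
      fun s => (-1 / (2 * (Real.pi : ℂ) * Complex.I)) * (1 * s - c)⁻¹ := by
    funext s
    rw [one_mul, div_mul_eq_div_div, div_eq_mul_inv _ (s - c)]
  rw [diracFunction, h, iteratedDeriv_const_mul_field, iteratedDeriv_eq_iterate,
    iter_deriv_inv_linear_sub]
  simp only [one_pow, mul_one, one_mul]
  rw [show (-1 - (m : ℤ)) = -((m + 1 : ℕ) : ℤ) by push_cast; ring, zpow_neg, zpow_natCast]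
  ring

lemma neg_one_pow_mul_self (n : ℕ) : (-1 : ℂ) ^ n * (-1) ^ n = 1 := by
  rw [← mul_pow, neg_one_mul, neg_neg, one_pow]

lemma neg_two_pi_I_mul_diracFunction (b : ℂ) (n : ℕ) (c s : ℂ) :
    -2 * (Real.pi : ℂ) * Complex.I * (b * (-1) ^ n / n.factorial * diracFunction n c s) =
      b / (s - c) ^ (n + 1) := by
  have hfact : (n.factorial : ℂ) ≠ 0 := Nat.cast_ne_zero.2 n.factorial_ne_zero
  calc -2 * (Real.pi : ℂ) * Complex.I * (b * (-1) ^ n / n.factorial * diracFunction n c s)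
      = b * ((-1) ^ n * (-1) ^ n) / (s - c) ^ (n + 1) := by
        rw [diracFunction_eq]
        field_simp [Complex.two_pi_I_ne_zero]
    _ = b / (s - c) ^ (n + 1) := by rw [neg_one_pow_mul_self, mul_one]

lemma rapidDecay_single (n : ℕ) (v : ℂ) : RapidDecay (Pi.single n v) := fun M _ =>
  summable_of_ne_finset_zero (s := {n}) fun m hm => by
    rw [Pi.single_eq_of_ne (by simpa using hm)]; simp

lemma diracFunction_eq_principalPart (m : ℕ) (c : ℂ) :
    diracFunction m c =
      principalPart (Pi.single m (-((-1) ^ m * m.factorial / (2 * Real.pi * Complex.I)))) c := by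
  funext s
  rw [diracFunction_eq, principalPart, tsum_eq_single m, Pi.single_eq_same]
  intro n hn
  rw [Pi.single_eq_of_ne hn, zero_div]

lemma exists_isDefiningFunction_diracFunction (hσ : 0 < σ) (hρ : ρ ≤ σ) (m : ℕ) :
    ∃ G : LaplaceHyperfunction 2 θ α ρ y, IsDefiningFunction G (diracFunction m (polar σ y)) := by
  have hgrowth : ExpGrowth 2 (slitSector θ α ρ y) (diracFunction m (polar σ y)) := by
    rw [diracFunction_eq_principalPart]
    exact ((rapidDecay_single _ _).hasSingularPart _).expGrowth (polar_ne_zero hσ y)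
      (polar_notMem_slitSector hσ hρ)
  exact ⟨Submodule.Quotient.mk ⟨_, hgrowth⟩, hgrowth, rfl⟩

lemma hasPairing_diracFunction {G : LaplaceHyperfunction k θ α ρ y} {m : ℕ} (hσ : 0 < σ)
    (hα : α < Real.pi) (h₁ : θ - α / 2 < y) (h₂ : y < θ + α / 2)
    (hG : IsDefiningFunction G (diracFunction m (polar σ y)))
    (hψ : ∀ β₁ β₂ : ℝ, θ - α / 2 < β₁ → β₂ < θ + α / 2 → DecaysOn 2 ψ (closedSector β₁ β₂)) :
    HasPairing G ψ ((-1) ^ m * iteratedDeriv m ψ (polar σ y)) := by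
  rw [diracFunction_eq_principalPart] at hG
  obtain ⟨v, hv, hs⟩ := hasPairing_principalPart (rapidDecay_single _ _) hσ hα h₁ h₂ hG hψ
  have hvalue := hs.unique (hasSum_single m fun n hn => by
    rw [Pi.single_eq_of_ne hn, zero_mul])
  have hfact : (m.factorial : ℂ) ≠ 0 := Nat.cast_ne_zero.2 m.factorial_ne_zero
  rw [Pi.single_eq_same] at hvalue
  convert! hv using 1
  rw [hvalue]
  field_simp [Complex.two_pi_I_ne_zero]

end Dirac

/-! ### The jump of the `1`-sum -/

section Jump

variable {f Q K : ℂ → ℂ} {b : ℕ → ℂ} {p : ℂ} {B σ y d dm dp κ τ ψ x β₁ β₂ : ℝ}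

namespace HasSingularPart

lemma add_comp_neg_mul_polar (h : HasSingularPart f b p Q B) (hp : p ∉ closedSector x x)
    {r : ℝ} (hr : 0 < r) :
    (f (polar r x) + f (-polar r x)) * K (polar r x) =
      principalPart b p (polar r x) * K (polar r x) +
        (Q (polar r x) + f (-polar r x)) * K (polar r x) := by
  rw [h.eq_add _ fun he => hp (he ▸ polar_mem_closedSector hr.le le_rfl le_rfl)]
  ring

lemma integrableOn_add_comp_neg_mul (h : HasSingularPart f b p Q B) (hp : p ∉ closedSector x x)
    (hK : DecaysOn 2 K (closedSector x x))
    (hQ : DecaysOn 2 (fun s => (Q s + f (-s)) * K s) (closedSector x x)) :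
    IntegrableOn (fun r => (f (polar r x) + f (-polar r x)) * K (polar r x)) (Ioi 0) :=
  ((h.rapidDecay.decaysOn_principalPart_mul (isClosed_closedSector x x) hp hK).integrableOn.add
    hQ.integrableOn).congr_fun (fun _ hr => (h.add_comp_neg_mul_polar hp hr).symm)
      measurableSet_Ioi

lemma rayIntegral_add_comp_neg_mul (h : HasSingularPart f b p Q B) (hp : p ∉ closedSector x x)
    (hK : DecaysOn 2 K (closedSector x x))
    (hQ : DecaysOn 2 (fun s => (Q s + f (-s)) * K s) (closedSector x x)) :
    rayIntegral (fun s => (f s + f (-s)) * K s) x =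
      rayIntegral (fun s => principalPart b p s * K s) x +
        rayIntegral (fun s => (Q s + f (-s)) * K s) x := by
  rw [← rayIntegral_add (h.rapidDecay.decaysOn_principalPart_mul (isClosed_closedSector x x)
    hp hK).integrableOn hQ.integrableOn]
  exact rayIntegral_congr fun r hr => h.add_comp_neg_mul_polar hp hr

/-- Only the principal part contributes to the jump: the remaining part of the integrand is
holomorphic between the two directions, so its integral does not change when the ray is rotated. -/
lemma hasSum_jump_add_comp_neg (h : HasSingularPart f b (polar σ y) Q B) (hσ : 0 < σ)
    (h₁ : β₁ < y) (h₂ : y < β₂) (hβ : β₂ - β₁ < Real.pi)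
    (hK : DecaysOn 2 K (closedSector β₁ β₂))
    (hQ : DecaysOn 2 (fun s => (Q s + f (-s)) * K s) (closedSector β₁ β₂)) :
    HasSum (fun n : ℕ => b n * (-(2 * Real.pi * Complex.I) *
        (iteratedDeriv n K (polar σ y) / n.factorial)))
      (rayIntegral (fun s => (f s + f (-s)) * K s) β₂ -
        rayIntegral (fun s => (f s + f (-s)) * K s) β₁) := by
  have hle : β₁ ≤ β₂ := (h₁.trans h₂).le
  have hleft : closedSector β₁ β₁ ⊆ closedSector β₁ β₂ := closedSector_subset le_rfl hle
  have hright : closedSector β₂ β₂ ⊆ closedSector β₁ β₂ := closedSector_subset hle le_rfl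
  rw [h.rayIntegral_add_comp_neg_mul (polar_notMem_closedSector_right hσ h₁ h₂ hβ)
      (hK.mono_set hright) (hQ.mono_set hright),
    h.rayIntegral_add_comp_neg_mul (polar_notMem_closedSector_left hσ h₁ h₂ hβ)
      (hK.mono_set hleft) (hQ.mono_set hleft),
    rayIntegral_eq_of_decaysOn ⟨hle, le_rfl⟩ ⟨le_rfl, hle⟩ hQ, add_sub_add_right_eq_sub]
  exact h.rapidDecay.hasSum_jump hσ h₁ h₂ hβ hK

lemma decaysOn_remainder_add_comp_neg_mul_heatKernel (h : HasSingularPart f b (polar σ y) Q B)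
    (hσ : 0 < σ) (hτ : 0 < τ) (h₁ : y - Real.pi < β₁) (h₂ : β₂ < y + Real.pi)
    (hcos : ∀ x, β₁ ≤ x → x ≤ β₂ → κ ≤ Real.cos (2 * x - ψ)) (hB : B < κ / (4 * τ)) :
    DecaysOn 2 (fun s => (Q s + f (-s)) * heatKernel τ ψ s) (closedSector β₁ β₂) :=
  ((h.growsOn_remainder.mono_set (subset_univ _)).add (h.growsOn_comp_neg
    (isClosed_closedSector _ _) (neg_polar_notMem_closedSector hσ h₁ h₂))).mul_heatKernel
      hτ hcos hB

lemma kSumConverges_of_decaysOn (h : HasSingularPart f b (polar σ y) Q B) (hσ : 0 < σ)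
    (hτ : 0 < τ) (hd : (d : Real.Angle) ≠ (2 * y : ℝ))
    (hp : polar σ y ∉ closedSector (d / 2) (d / 2))
    (hK : DecaysOn 2 (heatKernel τ ψ) (closedSector (d / 2) (d / 2)))
    (hQ : DecaysOn 2 (fun s => (Q s + f (-s)) * heatKernel τ ψ s)
      (closedSector (d / 2) (d / 2))) : KSumConverges 1 d (heatSeries f) τ ψ :=
  kSumConverges_of_integrableOn hτ (fun _ => h.continuedDeceleration_polar hσ hd)
    (h.integrableOn_add_comp_neg_mul hp hK hQ)

lemma kSum_jump (h : HasSingularPart f b (polar σ y) Q B) (hσ : 0 < σ) (hτ : 0 < τ)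
    (hm : dm < 2 * y) (hp : 2 * y < dp) (hlt : dp - dm < Real.pi)
    (hcos : ∀ x, dm / 2 ≤ x → x ≤ dp / 2 → κ ≤ Real.cos (2 * x - ψ)) (hB : B < κ / (4 * τ)) :
    KSumConverges 1 dp (heatSeries f) τ ψ ∧ KSumConverges 1 dm (heatSeries f) τ ψ ∧
      HasSum (fun n : ℕ => b n * (-(2 * Real.pi * Complex.I) *
        (iteratedDeriv n (heatKernel τ ψ) (polar σ y) / n.factorial)))
        (kSum 1 dp (heatSeries f) τ ψ - kSum 1 dm (heatSeries f) τ ψ) := by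
  have hm₂ : dm / 2 < y := by linarith
  have hp₂ : y < dp / 2 := by linarith
  have hlt₂ : dp / 2 - dm / 2 < Real.pi := by linarith
  have hle : dm / 2 ≤ dp / 2 := (hm₂.trans hp₂).le
  have hκ : 0 < κ := (div_pos_iff_of_pos_right (by positivity)).1 (h.exponent_pos.trans hB)
  have hK : DecaysOn 2 (heatKernel τ ψ) (closedSector (dm / 2) (dp / 2)) :=
    decaysOn_heatKernel hτ fun x h₁ h₂ => hκ.trans_le (hcos x h₁ h₂)
  have hQ := h.decaysOn_remainder_add_comp_neg_mul_heatKernel hσ hτ (by linarith) (by linarith)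
    hcos hB
  have hdm : (dm : Real.Angle) ≠ (2 * y : ℝ) := fun he =>
    hm.ne (eq_of_angle_coe_eq he (abs_lt.2 ⟨by linarith, by linarith⟩))
  have hdp : (dp : Real.Angle) ≠ (2 * y : ℝ) := fun he =>
    hp.ne' (eq_of_angle_coe_eq he (abs_lt.2 ⟨by linarith, by linarith⟩))
  refine ⟨h.kSumConverges_of_decaysOn hσ hτ hdp
    (polar_notMem_closedSector_right hσ hm₂ hp₂ hlt₂)
    (hK.mono_set (closedSector_subset hle le_rfl)) (hQ.mono_set (closedSector_subset hle le_rfl)),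
    h.kSumConverges_of_decaysOn hσ hτ hdm (polar_notMem_closedSector_left hσ hm₂ hp₂ hlt₂)
    (hK.mono_set (closedSector_subset le_rfl hle)) (hQ.mono_set (closedSector_subset le_rfl hle)),
    ?_⟩
  rw [kSum_eq_rayIntegral hτ fun _ => h.continuedDeceleration_polar hσ hdp,
    kSum_eq_rayIntegral hτ fun _ => h.continuedDeceleration_polar hσ hdm]
  exact h.hasSum_jump_add_comp_neg hσ hm₂ hp₂ hlt₂ hK hQ

end HasSingularPart

end Jump

/-! ### Translation of the initial value -/

section Translation

variable {z₀ z : ℂ} {θ R : ℝ} {φ : ℂ → ℂ}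

lemma polar_argAt (hz₀ : z₀ ≠ 0) (hθ : z₀ = polar ‖z₀‖ θ) (z : ℂ) :
    polar ‖z₀ - z‖ (argAt z₀ θ z) = z₀ - z := by
  calc polar ‖z₀ - z‖ (argAt z₀ θ z)
      = polar ‖z₀‖ θ * polar ‖(z₀ - z) / z₀‖ (Complex.arg ((z₀ - z) / z₀)) := by
        rw [polar_mul, norm_div, mul_div_cancel₀ _ (norm_ne_zero_iff.2 hz₀), argAt]
    _ = z₀ - z := by rw [← hθ, polar_norm_arg, mul_div_cancel₀ _ hz₀]

lemma tendsto_argAt (hz₀ : z₀ ≠ 0) (θ : ℝ) : Tendsto (argAt z₀ θ) (𝓝 0) (𝓝 θ) := by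
  unfold argAt
  have hdiv : Tendsto (fun z => (z₀ - z) / z₀) (𝓝 0) (𝓝 1) := by
    simpa [hz₀] using
      (show Continuous fun z : ℂ => (z₀ - z) / z₀ by fun_prop).tendsto 0
  simpa [Function.comp_def] using
    ((Complex.continuousAt_arg Complex.one_mem_slitPlane).tendsto.comp hdiv).const_add θ

lemma exists_ball_sub_mem_sector {α ρ T : ℝ} {S : Set ℝ} (hz₀ : z₀ ≠ 0)
    (hθ : z₀ = polar ‖z₀‖ θ) (hα : 0 < α) (hρ : ρ < ‖z₀‖) (hS : S ∈ 𝓝 θ) (hT : 0 < T) :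
    ∃ r > 0, r ≤ T ∧ ∀ z ∈ Metric.ball (0 : ℂ) r, z₀ - z ∈ sector θ α ∧ ρ ≤ ‖z₀ - z‖ ∧
      θ - α / 2 < argAt z₀ θ z ∧ argAt z₀ θ z < θ + α / 2 ∧ argAt z₀ θ z ∈ S := by
  have hnorm : ∀ᶠ z in 𝓝 (0 : ℂ), max ρ 0 < ‖z₀ - z‖ :=
    (show Continuous fun z : ℂ => ‖z₀ - z‖ by fun_prop).continuousAt.eventually
      (lt_mem_nhds (by simpa using ⟨hρ, hz₀⟩))
  have harg := (tendsto_argAt hz₀ θ).eventually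
    (inter_mem (Ioo_mem_nhds (a := θ - α / 2) (b := θ + α / 2) (by linarith) (by linarith)) hS)
  obtain ⟨r, hr, hball⟩ := Metric.eventually_nhds_iff_ball.1 (hnorm.and harg)
  refine ⟨min r T, lt_min hr hT, min_le_right r T, fun z hz => ?_⟩
  obtain ⟨hσ, ⟨h₁, h₂⟩, hS⟩ := hball z (Metric.ball_subset_ball (min_le_left r T) hz)
  rw [max_lt_iff] at hσ
  exact ⟨polar_argAt hz₀ hθ z ▸ polar_mem_sector hσ.2 h₁ h₂, hσ.1.le, h₁, h₂, hS⟩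

lemma IsFormalHeatSolution.eq_iteratedDeriv {u : ℕ → ℂ → ℂ} (hu : IsFormalHeatSolution φ R u)
    (n : ℕ) : ∀ z ∈ Metric.ball (0 : ℂ) R, u n z = iteratedDeriv (2 * n) φ z / n.factorial := by
  obtain ⟨-, hzero, hrec⟩ := hu
  induction n with
  | zero => simpa using hzero
  | succ n ih =>
    intro z hz
    have hev : u n =ᶠ[𝓝 z] fun w => (n.factorial : ℂ)⁻¹ * iteratedDeriv (2 * n) φ w := by
      filter_upwards [Metric.isOpen_ball.mem_nhds hz] with w hw
      rw [ih w hw, div_eq_inv_mul]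
    have hiter : iteratedDeriv 2 (iteratedDeriv (2 * n) φ) = iteratedDeriv (2 * (n + 1)) φ := by
      simp only [iteratedDeriv_eq_iterate]
      rw [← Function.iterate_add_apply, add_comm, mul_add, mul_one]
    have hstep := hrec n z hz
    rw [hev.iteratedDeriv_eq 2, iteratedDeriv_const_mul_field, hiter] at hstep
    rw [eq_div_iff (Nat.cast_ne_zero.2 (n + 1).factorial_ne_zero), Nat.factorial_succ]
    push_cast
    rw [mul_comm, mul_right_comm, hstep, mul_right_comm,
      inv_mul_cancel₀ (Nat.cast_ne_zero.2 n.factorial_ne_zero), one_mul]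

lemma IsFormalHeatSolution.seriesAt_eq {u : ℕ → ℂ → ℂ} (hu : IsFormalHeatSolution φ R u)
    (hz : z ∈ Metric.ball 0 R) : seriesAt u z = heatSeries fun s => φ (s + z) := by
  ext n
  rw [seriesAt, heatSeries, PowerSeries.coeff_mk, PowerSeries.coeff_mk,
    hu.eq_iteratedDeriv n z hz, iteratedDeriv_comp_add_const]
  simp only [zero_add]

lemma principalPart_sub (b : ℕ → ℂ) (p z : ℂ) :
    principalPart b (p - z) = fun s => ∑' n : ℕ, b n / (z + s - p) ^ (n + 1) :=
  funext fun s => (principalPart_add b p z s).symm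

lemma exists_hasSingularPart_translate {c : ℕ → ℂ} {Phi : ℂ → ℂ} (hPhi : ExpGrowth 2 univ Phi)
    (hφ : DifferentiableOn ℂ φ {z₀}ᶜ)
    (hsum : ∀ z : ℂ, 1 ≤ ‖z - z₀‖ →
      HasSum (fun n : ℕ => c n / (z - z₀) ^ (n + 1)) (φ z - Phi z)) :
    ∃ B > 0, ∀ z p, p = z₀ - z →
      HasSingularPart (fun s => φ (s + z)) c p (fun s => Phi (s + z)) B := by
  obtain ⟨hc, heq⟩ := rapidDecay_and_eq_principalPart
    (hφ.sub (hPhi.1.mono (subset_univ _))) hsum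
  obtain ⟨B, hB, hgrowth⟩ := hPhi.exists_growsOn_univ
  refine ⟨2 * B, by positivity, ?_⟩
  rintro z _ rfl
  refine ⟨by positivity, hc, ?_, fun s hs => ?_⟩
  · simpa only [add_comm] using hgrowth.comp_const_add hB.le z
  · have hsz : z + s ≠ z₀ := fun he => hs (eq_sub_of_add_eq' he)
    rw [← principalPart_add, ← heq _ hsz, add_comm s z]
    exact (sub_add_cancel _ _).symm

end Translation

/-! ### Hyperfunctions at a singular point -/

section SingularPoint

variable {k θ α ρ σ y : ℝ} {b : ℕ → ℂ} {p : ℂ}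

lemma RapidDecay.tendstoLocallyUniformlyOn_diracFunction (hb : RapidDecay b) {U : Set ℂ}
    (hp : p ∉ U) :
    TendstoLocallyUniformlyOn (fun (N : ℕ) (s : ℂ) => -2 * (Real.pi : ℂ) * Complex.I *
        ∑ n ∈ Finset.range N, b n * (-1) ^ n / (n.factorial : ℂ) * diracFunction n p s)
      (principalPart b p) atTop U := by
  simp only [Finset.mul_sum, neg_two_pi_I_mul_diracFunction]
  exact (hb.tendstoLocallyUniformlyOn p).mono fun s hs he => hp (mem_singleton_iff.1 he ▸ hs)

namespace HasSingularPart

variable {f Q : ℂ → ℂ} {B : ℝ}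

lemma exists_hyperfunction_eq_tsum_diracFunction (h : HasSingularPart f b (polar σ y) Q B)
    (hρ : 0 < ρ) (hρσ : ρ ≤ σ) (hα : α < Real.pi) (h₁ : θ - α / 2 < y) (h₂ : y < θ + α / 2) :
    ∃ (F : LaplaceHyperfunction 2 θ α ρ y) (Δ : ℕ → LaplaceHyperfunction 2 θ α ρ y),
      IsDefiningFunction F (fun s => f s + f (-s)) ∧ IsDefiningFunction F f ∧
      IsDefiningFunction F (principalPart b (polar σ y)) ∧
      (∀ n, IsDefiningFunction (Δ n) (diracFunction n (polar σ y))) ∧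
      TendstoLocallyUniformlyOn (fun (N : ℕ) (s : ℂ) => -2 * (Real.pi : ℂ) * Complex.I *
          ∑ n ∈ Finset.range N,
            b n * (-1) ^ n / (n.factorial : ℂ) * diracFunction n (polar σ y) s)
        (principalPart b (polar σ y)) atTop (slitSector θ α ρ y) ∧
      ∀ ψ : ℂ → ℂ, ExpDecay 2 (hatSector θ α ρ) ψ →
        (∀ n, HasPairing (Δ n) ψ ((-1) ^ n * iteratedDeriv n ψ (polar σ y))) ∧
        ∃ v : ℂ, HasPairing F ψ v ∧
          HasSum (fun n : ℕ => -2 * (Real.pi : ℂ) * Complex.I *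
            (b n * (-1) ^ n / (n.factorial : ℂ) *
              ((-1) ^ n * iteratedDeriv n ψ (polar σ y)))) v := by
  have hσ : 0 < σ := hρ.trans_le hρσ
  obtain ⟨F, hsum, hf, hprincipal⟩ := h.exists_hyperfunction hσ hρσ hα h₁ h₂
  choose Δ hΔ using exists_isDefiningFunction_diracFunction (θ := θ) (α := α) (y := y) hσ hρσ
  refine ⟨F, Δ, hsum, hf, hprincipal, hΔ,
    h.rapidDecay.tendstoLocallyUniformlyOn_diracFunction (polar_notMem_slitSector hσ hρσ),
    fun ψ hψ => ?_⟩
  have hdecay : ∀ β₁ β₂, θ - α / 2 < β₁ → β₂ < θ + α / 2 →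
      DecaysOn 2 ψ (closedSector β₁ β₂) := fun _ _ => hψ.decaysOn hρ
  obtain ⟨v, hv, hseries⟩ := hasPairing_principalPart h.rapidDecay hσ hα h₁ h₂ hprincipal hdecay
  refine ⟨fun n => hasPairing_diracFunction hσ hα h₁ h₂ (hΔ n) hdecay, v, hv, ?_⟩
  convert hseries using 2 with n
  linear_combination (-2 * Real.pi * Complex.I * b n / n.factorial *
    iteratedDeriv n ψ (polar σ y)) * neg_one_pow_mul_self n

lemma kSummable {d : ℝ} (h : HasSingularPart f b (polar σ y) Q B) (hσ : 0 < σ) (hne : d ≠ 2 * y)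
    (hd : |d - 2 * y| < Real.pi) : KSummable 1 d (heatSeries f) :=
  ⟨_, h.isContinuedDeceleration hσ fun he =>
    hne (eq_of_angle_coe_eq he (by linarith [Real.pi_pos]))⟩

end HasSingularPart

lemma sin_le_cos_of_abs_le {e x : ℝ} (he : 0 ≤ e) (hx : |x| ≤ Real.pi / 2 - e) :
    Real.sin e ≤ Real.cos x := by
  rw [← Real.cos_pi_div_two_sub, ← Real.cos_abs x]
  exact Real.cos_le_cos_of_nonneg_of_le_pi (abs_nonneg x) (by linarith [Real.pi_pos]) hx

lemma neg_two_pi_I_mul_iteratedDeriv_heatKernel (b : ℂ) (n : ℕ) (τ ψ : ℝ) (s : ℂ) :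
    b * (-(2 * Real.pi * Complex.I) * (iteratedDeriv n (heatKernel τ ψ) s / n.factorial)) =
      -Complex.I * ((Real.sqrt Real.pi : ℂ) / polar (Real.sqrt τ) (ψ / 2)) *
        (b / n.factorial *
          iteratedDeriv n (fun s : ℂ => Complex.exp (-s ^ 2 / (4 * polar τ ψ))) s) := by
  have hsq : (Real.sqrt Real.pi : ℂ) * Real.sqrt Real.pi = Real.pi := by
    rw [← Complex.ofReal_mul, Real.mul_self_sqrt Real.pi_pos.le]
  have hsqrt : (Real.sqrt Real.pi : ℂ) ≠ 0 :=
    Complex.ofReal_ne_zero.2 (Real.sqrt_pos.2 Real.pi_pos).ne'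
  unfold heatKernel
  rw [iteratedDeriv_const_mul_field, sqrt_four_mul_pi, ← hsq]
  push_cast
  field_simp

lemma HasSingularPart.exists_hyperfunction_kSum_sub_kSum {f Q : ℂ → ℂ} {B ε dm dp r : ℝ}
    (h : HasSingularPart f b (polar σ y) Q B) (hρ : 0 < ρ) (hρσ : ρ ≤ σ)
    (hr : r ≤ Real.sin (ε / 4) / (4 * B)) (hε : ε < Real.pi) (hα : α ≤ ε / 2)
    (h₁ : θ - α / 2 < y) (h₂ : y < θ + α / 2) (hp₁ : 2 * y < dp) (hp₂ : dp < 2 * θ + ε / 4)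
    (hm₁ : 2 * θ - ε / 4 < dm) (hm₂ : dm < 2 * y) :
    KSummable 1 dp (heatSeries f) ∧ KSummable 1 dm (heatSeries f) ∧
    ∃ F : LaplaceHyperfunction 2 θ α ρ y, IsDefiningFunction F (fun s => f s + f (-s)) ∧
      ∀ τ ψ : ℝ, 0 < τ → τ < r →
        2 * θ - (Real.pi - ε) / 2 < ψ → ψ < 2 * θ + (Real.pi - ε) / 2 →
        KSumConverges 1 dp (heatSeries f) τ ψ ∧ KSumConverges 1 dm (heatSeries f) τ ψ ∧
        HasPairing F (heatKernel τ ψ)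
          (kSum 1 dp (heatSeries f) τ ψ - kSum 1 dm (heatSeries f) τ ψ) ∧
        HasSum (fun n : ℕ => -Complex.I *
            ((Real.sqrt Real.pi : ℂ) / polar (Real.sqrt τ) (ψ / 2)) *
            (b n / (n.factorial : ℂ) *
              iteratedDeriv n (fun s : ℂ => Complex.exp (-s ^ 2 / (4 * polar τ ψ))) (polar σ y)))
          (kSum 1 dp (heatSeries f) τ ψ - kSum 1 dm (heatSeries f) τ ψ) := by
  have hσ : 0 < σ := hρ.trans_le hρσ
  have hα' : α < Real.pi := by linarith
  obtain ⟨F, hF, -, hprincipal⟩ := h.exists_hyperfunction hσ hρσ hα' h₁ h₂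
  refine ⟨h.kSummable hσ hp₁.ne' (abs_sub_lt_iff.2 ⟨by linarith, by linarith⟩),
    h.kSummable hσ hm₂.ne (abs_sub_lt_iff.2 ⟨by linarith, by linarith⟩), F, hF,
    fun τ ψ hτ hτr hψ₁ hψ₂ => ?_⟩
  have hcos : ∀ x, dm / 2 ≤ x → x ≤ dp / 2 → Real.sin (ε / 4) ≤ Real.cos (2 * x - ψ) :=
    fun x hx₁ hx₂ => sin_le_cos_of_abs_le (by linarith)
      (abs_le.2 ⟨by linarith, by linarith⟩)
  have hBτ : B < Real.sin (ε / 4) / (4 * τ) := by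
    have hτB := (lt_div_iff₀ (mul_pos four_pos h.exponent_pos)).1 (hτr.trans_le hr)
    rw [lt_div_iff₀ (mul_pos four_pos hτ)]
    linarith
  obtain ⟨hdp, hdm, hjump⟩ := h.kSum_jump hσ hτ hm₂ hp₁ (by linarith) hcos hBτ
  have hK : ∀ β₁ β₂, θ - α / 2 < β₁ → β₂ < θ + α / 2 →
      DecaysOn 2 (heatKernel τ ψ) (closedSector β₁ β₂) := fun β₁ β₂ hβ₁ hβ₂ =>
    decaysOn_heatKernel hτ fun x hx₁ hx₂ => Real.cos_pos_of_mem_Ioo ⟨by linarith, by linarith⟩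
  obtain ⟨v, hv, hseries⟩ := hasPairing_principalPart h.rapidDecay hσ hα' h₁ h₂ hprincipal hK
  refine ⟨hdp, hdm, hjump.unique hseries ▸ hv, ?_⟩
  simpa only [neg_two_pi_I_mul_iteratedDeriv_heatKernel] using hjump

end SingularPoint

end

theorem theorem1
    (z₀ : ℂ) (hz₀ : z₀ ≠ 0)
    -- `θ` is any value of `arg z₀`, and `δ = 2θ`
    (θ : ℝ) (hθ : z₀ = polar ‖z₀‖ θ)
    -- the coefficients `a₁, a₂, …` (the value `a 0` plays no role)
    (a : ℕ → ℂ) (ha : limsup (fun n : ℕ => ‖a n‖ₑ ^ (1 / (n : ℝ))) atTop < 1)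
    (Phi : ℂ → ℂ) (hPhi : ExpGrowth 2 univ Phi)
    (φ : ℂ → ℂ) (hφ : DifferentiableOn ℂ φ {z₀}ᶜ)
    (hsum : ∀ z : ℂ, 1 ≤ ‖z - z₀‖ →
      HasSum (fun n : ℕ => a (n + 1) / (z - z₀) ^ (n + 1)) (φ z - Phi z))
    (R : ℝ) (hR : 0 < R) (u : ℕ → ℂ → ℂ) (hu : IsFormalHeatSolution φ R u) :
    -- the Stokes line (for `z = 0` this is the direction `δ = 2θ`)
    ((∃ n : ℕ, 1 ≤ n ∧ a n ≠ 0) → ∀ z : ℂ, ‖z‖ < R → ‖z‖ < ‖z₀‖ →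
      IsStokesLine 1 (2 * argAt z₀ θ z) (seriesAt u z)) ∧
    -- the hyperfunction `F_z`
    (∀ α ρ : ℝ, 0 < α → α < Real.pi → 0 < ρ → ρ < ‖z₀‖ →
      ∃ r : ℝ, 0 < r ∧ ∀ z ∈ Metric.ball (0 : ℂ) r,
        z₀ - z ∈ sector θ α ∧
        ∃ (F : LaplaceHyperfunction 2 θ α ρ (argAt z₀ θ z))
          (Δ : ℕ → LaplaceHyperfunction 2 θ α ρ (argAt z₀ θ z)),
          IsDefiningFunction F (fun s => φ (s + z) + φ (z - s)) ∧
          IsDefiningFunction F (fun s => φ (s + z)) ∧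
          IsDefiningFunction F (fun s => ∑' n : ℕ, a (n + 1) / (z + s - z₀) ^ (n + 1)) ∧
          -- `Δ n` is the `n`-th derivative of the Dirac function at `s = z₀ - z`
          (∀ n, IsDefiningFunction (Δ n) (diracFunction n (z₀ - z))) ∧
          -- the expansion in terms of defining functions
          TendstoLocallyUniformlyOn
            (fun (N : ℕ) (s : ℂ) => -2 * (Real.pi : ℂ) * Complex.I *
              ∑ n ∈ Finset.range N,
                a (n + 1) * (-1) ^ n / (n.factorial : ℂ) * diracFunction n (z₀ - z) s)
            (fun s => ∑' n : ℕ, a (n + 1) / (z + s - z₀) ^ (n + 1)) atTop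
            (slitSector θ α ρ (argAt z₀ θ z)) ∧
          -- the expansion in terms of analytic functionals
          ∀ ψ : ℂ → ℂ, ExpDecay 2 (hatSector θ α ρ) ψ →
            (∀ n, HasPairing (Δ n) ψ ((-1) ^ n * iteratedDeriv n ψ (z₀ - z))) ∧
            ∃ v : ℂ, HasPairing F ψ v ∧
              HasSum (fun n : ℕ => -2 * (Real.pi : ℂ) * Complex.I *
                (a (n + 1) * (-1) ^ n / (n.factorial : ℂ) *
                  ((-1) ^ n * iteratedDeriv n ψ (z₀ - z)))) v) ∧
    -- the jump
    (∀ ε : ℝ, 0 < ε → ε < Real.pi → ∃ η : ℝ, 0 < η ∧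
      ∀ α ρ : ℝ, 0 < α → α ≤ ε / 2 → 0 < ρ → ρ < ‖z₀‖ →
      ∀ δp δm : ℝ, 2 * θ < δp → δp < 2 * θ + η → 2 * θ - η < δm → δm < 2 * θ →
      ∃ r : ℝ, 0 < r ∧ ∀ z ∈ Metric.ball (0 : ℂ) r,
        z₀ - z ∈ sector θ α ∧
        KSummable 1 δp (seriesAt u z) ∧ KSummable 1 δm (seriesAt u z) ∧
        ∃ F : LaplaceHyperfunction 2 θ α ρ (argAt z₀ θ z),
          IsDefiningFunction F (fun s => φ (s + z) + φ (z - s)) ∧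
          -- `t = τ e^{iψ}` in the sector in direction `δ` with opening `π - ε` and radius `r`
          ∀ τ ψ : ℝ, 0 < τ → τ < r →
            2 * θ - (Real.pi - ε) / 2 < ψ → ψ < 2 * θ + (Real.pi - ε) / 2 →
            KSumConverges 1 δp (seriesAt u z) τ ψ ∧ KSumConverges 1 δm (seriesAt u z) τ ψ ∧
            HasPairing F (heatKernel τ ψ)
              (kSum 1 δp (seriesAt u z) τ ψ - kSum 1 δm (seriesAt u z) τ ψ) ∧
            HasSum (fun n : ℕ => -Complex.I *
                ((Real.sqrt Real.pi : ℂ) / polar (Real.sqrt τ) (ψ / 2)) *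
                (a (n + 1) / (n.factorial : ℂ) *
                  iteratedDeriv n (fun s : ℂ => Complex.exp (-s ^ 2 / (4 * polar τ ψ))) (z₀ - z)))
              (kSum 1 δp (seriesAt u z) τ ψ - kSum 1 δm (seriesAt u z) τ ψ)) := by
  obtain ⟨B, hB, htranslate⟩ := exists_hasSingularPart_translate hPhi hφ hsum
  have hpole : ∀ z, polar ‖z₀ - z‖ (argAt z₀ θ z) = z₀ - z := polar_argAt hz₀ hθ
  refine ⟨?stokes, ?hyperfunction, ?jump⟩
  case stokes =>
    rintro ⟨n, hn, han⟩ z hzR hz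
    have hσ : 0 < ‖z₀ - z‖ := norm_sub_pos_iff.2 fun he => hz.ne (he ▸ rfl)
    rw [hu.seriesAt_eq (mem_ball_zero_iff.2 hzR)]
    refine (htranslate z _ (hpole z)).isStokesLine hσ (Function.ne_iff.2 ⟨n - 1, ?_⟩)
    rwa [Nat.sub_add_cancel hn]
  case hyperfunction =>
    intro α ρ hα hαpi hρ hρz
    obtain ⟨r, hr, -, hball⟩ := exists_ball_sub_mem_sector hz₀ hθ hα hρz univ_mem one_pos
    refine ⟨r, hr, fun z hz => ?_⟩
    obtain ⟨hmem, hρσ, h₁, h₂, -⟩ := hball z hz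
    have hpart := htranslate z _ (hpole z)
    exact ⟨hmem, by simpa only [hpole, neg_add_eq_sub, principalPart_sub] using
      hpart.exists_hyperfunction_eq_tsum_diracFunction hρ hρσ hαpi h₁ h₂⟩
  case jump =>
    intro ε hε hεpi
    refine ⟨ε / 4, by positivity, fun α ρ hα hαε hρ hρz δp δm hp₁ hp₂ hm₁ hm₂ => ?_⟩
    have hsin : 0 < Real.sin (ε / 4) := Real.sin_pos_of_pos_of_lt_pi (by linarith) (by linarith)
    have hδ : Ioo (δm / 2) (δp / 2) ∈ 𝓝 θ := Ioo_mem_nhds (by linarith) (by linarith)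
    obtain ⟨r, hr, hrT, hball⟩ := exists_ball_sub_mem_sector hz₀ hθ hα hρz hδ
      (show 0 < min R (Real.sin (ε / 4) / (4 * B)) by positivity)
    refine ⟨r, hr, fun z hz => ?_⟩
    obtain ⟨hmem, hρσ, h₁, h₂, hm, hp⟩ := hball z hz
    have hpart := htranslate z _ (hpole z)
    rw [hu.seriesAt_eq (Metric.ball_subset_ball (hrT.trans (min_le_left _ _)) hz)]
    have hjump := hpart.exists_hyperfunction_kSum_sub_kSum hρ hρσ (hrT.trans (min_le_right _ _))
      hεpi hαε h₁ h₂ (by linarith) hp₂ hm₁ (by linarith)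
    exact ⟨hmem, by simpa only [hpole, neg_add_eq_sub] using hjump⟩
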